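/- Let $(X,d)$ be a complete metric space with a Borel measure $\mu$ that is doubling: for some constant $C_D$, $0<\mu(B(z,2r))\le C_D\,\mu(B(z,r))<\infty$ for all $z\in X$ and $r>0$. For $A\subset X$ let $$\mathcal H(A)=\lim_{\delta\to0^+}\inf\Big\{\sum_i\frac{\mu(B_i)}{\operatorname{rad}(B_i)}\ :\ \{B_i\}\text{ a countable family of balls in }X,\ \operatorname{rad}(B_i)<\delta,\ A\subset\bigcup_iB_i\Big\}$$ be the co-dimension $1$ Hausdorff measure. For an open set $U\subset X$ and $u:U\to\mathbb R$ let $I(u:U)=\inf_g\int_Ug\,d\mu$, where $g$ runs over the Borel upper gradients of $u$ in $U$, i.e. the Borel functions $g:U\to[0,\infty]$ with $|u(y)-u(x)|\le\int_\gamma g\,ds$ for every rectifiable curve $\gamma$ in $U$ with end points $x,y$. For $u\in L^1(U)$ let $$\|Du\|(U)=\inf\Big\{\liminf_{i\to\infty}I(u_i:U)\ :\ u_i\text{ locally Lipschitz on }U,\ u_i\to u\text{ in }L^1(U)\Big\},$$ $\|u\|_{BV(U)}=\|u\|_{L^1(U)}+\|Du\|(U)$, and $BV(U)=\{u\in L^1(U):\|Du\|(U)<\infty\}$.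 Theorem. Let $\Omega\subset X$ be a bounded domain (a non-empty, open, connected, bounded set) whose boundary is Ahlfors regular of co-dimension $1$: there is a constant $C_A\ge1$ such that $$C_A^{-1}\frac{\mu(B(x,r))}{r}\le\mathcal H(B(x,r)\cap\partial\Omega)\le C_A\frac{\mu(B(x,r))}{r}\qquad\text{for all }x\in\partial\Omega,\ 0<r\le\operatorname{diam}(\Omega).$$ Let $L^1(\partial\Omega)$ be taken with respect to $\mathcal H|_{\partial\Omega}$. Then there is a bounded, in general nonlinear, extension operator $\operatorname{Ext}:L^1(\partial\Omega)\to BV(\Omega)$, that is, a (not necessarily linear) map for which there is a constant $C$ with $$\|\operatorname{Ext}f\|_{BV(\Omega)}\le C\,\|f\|_{L^1(\partial\Omega)}\qquad\text{for all }f\in L^1(\partial\Omega),$$ such that $T\circ\operatorname{Ext}$ is the identity on $L^1(\partial\Omega)$: for every $f\in L^1(\partial\Omega)$ the trace of $\operatorname{Ext}f$ exists $\mathcal H$-a.e. on $\partial\Omega$ and equals $f$, i.e. for $\mathcal H$-a.e. $z\in\partial\Omega$ $$\limsup_{r\to0^+}\frac1{\mu(B(z,r)\cap\Omega)}\int_{B(z,r)\cap\Omega}|\operatorname{Ext}f(y)-f(z)|\,d\mu(y)=0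 .$$ -/

import Mathlib

open Set Filter Topology MeasureTheory
open scoped NNReal ENNReal

noncomputable section

namespace CodimOneTrace

variable {X : Type*} [MetricSpace X]

section Measures

variable [MeasurableSpace X]

/-- `μ` is doubling: for some `C_D`, `0 < μ(B(z,2r)) ≤ C_D μ(B(z,r)) < ∞` for all `z` and `r > 0`. -/
def IsDoubling (μ : Measure X) : Prop :=
  ∃ C : ℝ≥0, ∀ (z : X) (r : ℝ), 0 < r →
    0 < μ (Metric.ball z (2 * r)) ∧
    μ (Metric.ball z (2 * r)) ≤ C * μ (Metric.ball z r) ∧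
    C * μ (Metric.ball z r) < ∞

/-- The quotient `μ(B) / rad(B)` of the ball with centre `p.1` and radius `p.2`. -/
def ballWeight (μ : Measure X) (p : X × ℝ) : ℝ≥0∞ :=
  μ (Metric.ball p.1 p.2) / ENNReal.ofReal p.2

/-- `T` is a countable family of balls (recorded as pairs (centre, radius)) of positive radius less
than `δ` that covers `A`. -/
structure IsBallCover (δ : ℝ) (A : Set X) (T : Set (X × ℝ)) : Prop where
  countable : T.Countable
  radius : ∀ p ∈ T, 0 < p.2 ∧ p.2 < δ
  cover : A ⊆ ⋃ p ∈ T, Metric.ball p.1 p.2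

/-- The codimension one Hausdorff content at scale `δ`: the infimum of `∑ μ(B_i) / rad(B_i)` over
all countable covers by balls of radius less than `δ`. -/
def codimOneContent (μ : Measure X) (δ : ℝ) : OuterMeasure X where
  measureOf A := ⨅ (T : Set (X × ℝ)) (_ : IsBallCover δ A T), ∑' p : T, ballWeight μ p
  empty := by
    refine le_antisymm ?_ bot_le
    refine (iInf₂_le (∅ : Set (X × ℝ)) ⟨countable_empty, by simp, by simp⟩).trans ?_
    simp
  mono := by
    intro A B hAB
    exact le_iInf₂ fun T hT => iInf₂_le T ⟨hT.countable, hT.radius, hAB.trans hT.cover⟩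
  iUnion_nat := by
    intro s _
    refine ENNReal.le_of_forall_pos_le_add fun ε hε hfin => ?_
    obtain ⟨ε', hε'0, hε'⟩ :=
      ENNReal.exists_pos_sum_of_countable (ENNReal.coe_pos.2 hε).ne' ℕ
    have key : ∀ i, ∃ T : Set (X × ℝ), IsBallCover δ (s i) T ∧ ∑' p : T, ballWeight μ p ≤
        (⨅ (T : Set (X × ℝ)) (_ : IsBallCover δ (s i) T), ∑' p : T, ballWeight μ p) + ε' i := by
      intro i
      have hi := ne_top_of_le_ne_top hfin.ne (ENNReal.le_tsum i)
      have hlt := ENNReal.lt_add_right hi (ENNReal.coe_pos.2 (hε'0 i)).ne'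
      obtain ⟨T, hT⟩ := iInf_lt_iff.1 hlt
      obtain ⟨hT1, hT2⟩ := iInf_lt_iff.1 hT
      exact ⟨T, hT1, hT2.le⟩
    choose T hT hTle using key
    have hcov : IsBallCover δ (⋃ i, s i) (⋃ i, T i) := by
      refine ⟨countable_iUnion fun i => (hT i).countable, ?_, ?_⟩
      · intro p hp
        obtain ⟨i, hi⟩ := mem_iUnion.1 hp
        exact (hT i).radius p hi
      · intro x hx
        obtain ⟨i, hi⟩ := mem_iUnion.1 hx
        obtain ⟨p, hp, hxp⟩ := mem_iUnion₂.1 ((hT i).cover hi)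
        exact mem_iUnion₂.2 ⟨p, mem_iUnion.2 ⟨i, hp⟩, hxp⟩
    refine (iInf₂_le _ hcov).trans ?_
    refine (ENNReal.tsum_iUnion_le_tsum (ballWeight μ) T).trans ?_
    refine (ENNReal.tsum_le_tsum hTle).trans ?_
    rw [ENNReal.tsum_add]
    gcongr

/-- The codimension one Hausdorff outer measure. The content at scale `δ` increases as `δ` decreases,
so its limit as `δ → 0⁺` is the supremum over `δ > 0`. -/
def codimOneOuter (μ : Measure X) : OuterMeasure X :=
  ⨆ (δ : ℝ) (_ : 0 < δ), codimOneContent μ δ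

lemma codimOneContent_anti (μ : Measure X) {δ δ' : ℝ} (h : δ ≤ δ') (A : Set X) :
    codimOneContent μ δ' A ≤ codimOneContent μ δ A :=
  le_iInf₂ fun T hT =>
    iInf₂_le T ⟨hT.countable, fun p hp => ⟨(hT.radius p hp).1, (hT.radius p hp).2.trans_le h⟩,
      hT.cover⟩

lemma codimOneOuter_apply (μ : Measure X) (A : Set X) :
    codimOneOuter μ A = ⨆ (δ : ℝ) (_ : 0 < δ), codimOneContent μ δ A := by
  simp only [codimOneOuter, OuterMeasure.iSup_apply]

lemma codimOneOuter_isMetric (μ : Measure X) : (codimOneOuter μ).IsMetric := by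
  rintro s t ⟨ε, hε, hst⟩
  refine le_antisymm (measure_union_le s t) ?_
  obtain ⟨η, hη0, hηε⟩ : ∃ η : ℝ, 0 < η ∧ ENNReal.ofReal (2 * η) ≤ ε := by
    have h1 : min ε 1 ≠ ∞ := (min_le_right _ _).trans_lt ENNReal.one_lt_top |>.ne
    have h2 : 0 < (min ε 1).toReal :=
      ENNReal.toReal_pos (by simp [hε]) h1
    refine ⟨(min ε 1).toReal / 2, by positivity, ?_⟩
    rw [mul_div_cancel₀ _ (two_ne_zero), ENNReal.ofReal_toReal h1]
    exact min_le_left _ _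
  have small : ∀ δ : ℝ, 0 < δ → δ ≤ η →
      codimOneContent μ δ s + codimOneContent μ δ t ≤ codimOneContent μ δ (s ∪ t) := by
    intro δ _ hδη
    refine le_iInf₂ fun T hT => ?_
    have part : ∀ a : Set X, a ⊆ s ∪ t →
        IsBallCover δ a {p ∈ T | (Metric.ball p.1 p.2 ∩ a).Nonempty} := by
      intro a ha
      refine ⟨hT.countable.mono (sep_subset _ _), fun p hp => hT.radius p hp.1, fun x hx => ?_⟩
      obtain ⟨p, hp, hxp⟩ := mem_iUnion₂.1 (hT.cover (ha hx))
      exact mem_iUnion₂.2 ⟨p, ⟨hp, x, hxp, hx⟩, hxp⟩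
    have disj : Disjoint {p ∈ T | (Metric.ball p.1 p.2 ∩ s).Nonempty}
        {p ∈ T | (Metric.ball p.1 p.2 ∩ t).Nonempty} := by
      rw [Set.disjoint_left]
      rintro p ⟨hp, x, hxp, hxs⟩ ⟨_, y, hyp, hyt⟩
      have h1 : dist x y < 2 * η := by
        have h3 := dist_triangle_right x y p.1
        have h4 := (hT.radius p hp).2
        rw [Metric.mem_ball] at hxp hyp
        linarith
      have h2 := hst x hxs y hyt
      rw [edist_dist] at h2
      exact absurd (hηε.trans h2) (not_le.2 ((ENNReal.ofReal_lt_ofReal_iff (by positivity)).2 h1))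
    calc codimOneContent μ δ s + codimOneContent μ δ t
        ≤ ∑' p : {p ∈ T | (Metric.ball p.1 p.2 ∩ s).Nonempty}, ballWeight μ p +
          ∑' p : {p ∈ T | (Metric.ball p.1 p.2 ∩ t).Nonempty}, ballWeight μ p :=
          add_le_add (iInf₂_le _ (part s subset_union_left)) (iInf₂_le _ (part t subset_union_right))
      _ = ∑' p : ({p ∈ T | (Metric.ball p.1 p.2 ∩ s).Nonempty} ∪
            {p ∈ T | (Metric.ball p.1 p.2 ∩ t).Nonempty} : Set (X × ℝ)), ballWeight μ p :=
          (ENNReal.summable.tsum_union_disjoint disj ENNReal.summable).symm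
      _ ≤ ∑' p : T, ballWeight μ p :=
          ENNReal.tsum_mono_subtype _ (union_subset (sep_subset _ _) (sep_subset _ _))
  simp only [codimOneOuter_apply]
  refine ENNReal.biSup_add_biSup_le' ⟨1, one_pos⟩ ⟨1, one_pos⟩ fun δ₁ h₁ δ₂ h₂ => ?_
  have h0 : 0 < min η (min δ₁ δ₂) := lt_min hη0 (lt_min h₁ h₂)
  refine le_trans ?_ (le_iSup₂ (f := fun δ (_ : 0 < δ) => codimOneContent μ δ (s ∪ t)) _ h0)
  refine le_trans (add_le_add ?_ ?_) (small _ h0 (min_le_left _ _))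
  · exact codimOneContent_anti μ ((min_le_right _ _).trans (min_le_left _ _)) s
  · exact codimOneContent_anti μ ((min_le_right _ _).trans (min_le_right _ _)) t

/-- The codimension one Hausdorff measure `𝓗`, as a Borel measure on `X`. -/
def codimOneHausdorff [BorelSpace X] (μ : Measure X) : Measure X :=
  (codimOneOuter μ).toMeasure (codimOneOuter_isMetric μ).le_caratheodory

/-- The measure on the boundary of `Ω`: the restriction of `𝓗` to `∂Ω`. -/
def boundaryMeasure [BorelSpace X] (μ : Measure X) (Ω : Set X) : Measure X :=
  (codimOneHausdorff μ).restrict (frontier Ω)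

/-- Ahlfors codimension one regularity of `∂Ω`: for some `C ≥ 1`,
`C⁻¹ μ(B(x,r))/r ≤ 𝓗(B(x,r) ∩ ∂Ω) ≤ C μ(B(x,r))/r` for all `x ∈ ∂Ω` and `0 < r ≤ diam Ω`. -/
def IsCodimOneRegularBoundary [BorelSpace X] (μ : Measure X) (Ω : Set X) : Prop :=
  ∃ C : ℝ≥0, 1 ≤ C ∧ ∀ x ∈ frontier Ω, ∀ r : ℝ, 0 < r → r ≤ Metric.diam Ω →
    (C : ℝ≥0∞)⁻¹ * (μ (Metric.ball x r) / ENNReal.ofReal r) ≤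
        codimOneHausdorff μ (Metric.ball x r ∩ frontier Ω) ∧
      codimOneHausdorff μ (Metric.ball x r ∩ frontier Ω) ≤
        C * (μ (Metric.ball x r) / ENNReal.ofReal r)

end Measures

/-- `γ : [a, b] → U` is a rectifiable curve in `U`: continuous and of finite length. -/
structure IsRectifiableCurve (γ : ℝ → X) (a b : ℝ) (U : Set X) : Prop where
  le : a ≤ b
  continuousOn : ContinuousOn γ (Icc a b)
  finite_length : eVariationOn γ (Icc a b) ≠ ∞
  mapsTo : MapsTo γ (Icc a b) U

/-- The integral `∫_γ g ds` of `g` along the rectifiable curve `γ : [a, b] → X`: the integral of `g`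
over `[0, length γ]` along the arc length parametrization of `γ`. -/
def arcLengthIntegral (g : X → ℝ≥0∞) (γ : ℝ → X) (a b : ℝ) : ℝ≥0∞ :=
  ∫⁻ t in Icc 0 (eVariationOn γ (Icc a b)).toReal, g (naturalParameterization γ (Icc a b) a t)

variable [MeasurableSpace X]

/-- The Borel function `g` is an upper gradient of `u` in `U`:
`|u(γ(b)) - u(γ(a))| ≤ ∫_γ g ds` for all rectifiable curves `γ : [a, b] → U`. -/
def IsUpperGradient (U : Set X) (u : X → ℝ) (g : X → ℝ≥0∞) : Prop :=
  Measurable g ∧ ∀ (γ : ℝ → X) (a b : ℝ), IsRectifiableCurve γ a b U →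
    ENNReal.ofReal |u (γ b) - u (γ a)| ≤ arcLengthIntegral g γ a b

/-- `I(u : U)`, the infimum of `∫_U g dμ` over all upper gradients `g` of `u` in `U`. -/
def upperGradientEnergy (μ : Measure X) (U : Set X) (u : X → ℝ) : ℝ≥0∞ :=
  ⨅ (g : X → ℝ≥0∞) (_ : IsUpperGradient U u g), ∫⁻ x in U, g x ∂μ

/-- The total variation `‖Du‖(U)`: the infimum of `liminf I(u_i : U)` over all sequences of locally
Lipschitz functions `u_i` on `U` with `u_i → u` in `L¹(U)`. -/
def totalVariation (μ : Measure X) (U : Set X) (u : X → ℝ) : ℝ≥0∞ :=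
  ⨅ (v : ℕ → X → ℝ) (_ : ∀ i, LocallyLipschitzOn U (v i))
    (_ : Tendsto (fun i => eLpNorm (v i - u) 1 (μ.restrict U)) atTop (𝓝 0)),
    liminf (fun i => upperGradientEnergy μ U (v i)) atTop

/-- The `BV(U)` norm `‖u‖_{L¹(U)} + ‖Du‖(U)`, with value `∞` off `BV(U)`. -/
def bvNorm (μ : Measure X) (U : Set X) (u : X → ℝ) : ℝ≥0∞ :=
  eLpNorm u 1 (μ.restrict U) + totalVariation μ U u

/-- The space `BV(U)`: the classes in `L¹(U)` of finite total variation on `U`. -/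
def BV (μ : Measure X) (U : Set X) : Set (Lp ℝ 1 (μ.restrict U)) :=
  {u | totalVariation μ U u < ∞}

/-- The number `c` is the trace at `z` of the function `u` on `Ω`:
the limit superior as `r → 0⁺` of the mean of `|u - c|` over `B(z,r) ∩ Ω` is zero. -/
def HasTraceAt (μ : Measure X) (Ω : Set X) (u : X → ℝ) (z : X) (c : ℝ) : Prop :=
  limsup (fun r : ℝ => ⨍⁻ y in Metric.ball z r ∩ Ω, ENNReal.ofReal |u y - c| ∂μ) (𝓝[>] 0) = 0

/-- The trace `Tu` of the function `u` on `Ω` is well defined and equal to `f`, as a function on `∂Ω`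
up to `𝓗`-null sets. -/
def HasTrace [BorelSpace X] (μ : Measure X) (Ω : Set X) (u f : X → ℝ) : Prop :=
  ∀ᵐ z ∂(boundaryMeasure μ Ω), HasTraceAt μ Ω u z (f z)

end CodimOneTrace

end

/-! The extension runs through better and better Lipschitz approximations of `f` as the boundary is
approached. Choose bounded Lipschitz functions `F k` on `X` with `F 0 = 0` and `‖f - F k‖ ≤ 2⁻ᵏ ‖f‖`
in `L¹(∂Ω)`, and scales `ρ k` that at least halve at each step. Put `u = ∑ (F (k+1) - F k) χ_k`,
where the cutoff `χ_k` is `1` up to distance `ρ k` from `∂Ω` and `0` from distance `2 ρ k` on. The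
sum is locally finite in `Ω` and telescopes: `u` is `F n` at distances between `2 ρ n` and `ρ
(n-1)`, and passes from `F n` to `F (n+1)` between `2 ρ n` and `ρ n` (`exists_layerSum_eq`).

Energy: with `G = F (k+1) - F k` of Lipschitz constant `Λ`, the `k`-th term has an upper gradient
bounded by `Λ + |G| / ρ` and supported in a layer of width `3ρ`. Codimension one regularity makes
the `μ`-measure of a layer of width `ρ` comparable, ball by ball, to `ρ` times the boundary measure,
so the integral of `|G| / ρ` is controlled by `‖G‖` in `L¹(∂Ω)` up to an error that vanishes with
`ρ` (`exists_lintegral_layer_le`, `exists_lintegral_layerGradient_le`). For `ρ k` small in terms of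
the Lipschitz constants, the energies sum to a multiple of `‖f‖`, and no Poincaré inequality is
needed.

Trace: at almost every `z` one has `F k z → f z`. A ball at `z` of radius about `2⁻ᵏ / Λ k` sees
little oscillation of `F 0, …, F k`, so outside the layer of width `2 ρ k` the function `u` is close
to `f z` there (`abs_layerSum_sub_le`). Inside that layer the only control is the sup bounds of the
`F i`, but `ρ k` is taken so small that the layer is negligible against all such balls at once;
compactness of `∂Ω` makes this uniform (`iInf_measure_ball_inter_pos`,
`lintegral_enorm_layerSum_le`). The approximants and scales depend on `f`, which is why the operator
is nonlinear. -/

noncomputable section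

namespace CodimOneTrace

/-! ### Arc length parametrization and a slope criterion for upper gradients -/

section ArcLength

variable {X : Type*} [MetricSpace X]

/-- The length function of a continuous curve of finite length is continuous. -/
lemma continuousOn_variationOnFromTo {γ : ℝ → X} {a b : ℝ}
    (hc : ContinuousOn γ (Icc a b)) (hf : eVariationOn γ (Icc a b) ≠ ∞) :
    ContinuousOn (variationOnFromTo γ (Icc a b) a) (Icc a b) := by
  intro x hx
  have ha : a ∈ Icc a b := left_mem_Icc.2 (hx.1.trans hx.2)
  have hbv : BoundedVariationOn γ (Icc a b) := hf
  have h1 := hbv.tendsto_eVariationOn_Icc_zero_left (x := x) ((hc x hx).mono inter_subset_left)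
  have h2 := hbv.tendsto_eVariationOn_Icc_zero_right x ((hc x hx).mono inter_subset_left)
  have h3 := (ENNReal.tendsto_toReal ENNReal.zero_ne_top).comp (by simpa using h1.add h2)
  rw [ContinuousWithinAt, tendsto_iff_dist_tendsto_zero]
  refine squeeze_zero' (Eventually.of_forall fun _ => dist_nonneg) ?_ h3
  filter_upwards [self_mem_nhdsWithin] with y hy
  have hfin : ∀ u v, eVariationOn γ (Icc a b ∩ Icc u v) ≠ ∞ := fun u v =>
    ne_top_of_le_ne_top hf (eVariationOn.mono _ inter_subset_left)
  rw [Real.dist_eq, ← variationOnFromTo.add hbv.locallyBoundedVariationOn ha hx hy,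
    add_sub_cancel_left, Function.comp, ENNReal.toReal_add (hfin _ _) (hfin _ _)]
  rcases le_total x y with h | h
  · rw [variationOnFromTo.eq_of_le _ _ h, abs_of_nonneg ENNReal.toReal_nonneg]
    exact le_add_of_nonneg_left ENNReal.toReal_nonneg
  · rw [variationOnFromTo.eq_of_ge _ _ h, abs_neg, abs_of_nonneg ENNReal.toReal_nonneg]
    exact le_add_of_nonneg_right ENNReal.toReal_nonneg

/-- `naturalParameterization` is meaningful only at values of the length function; by continuity and
the intermediate value theorem these fill the whole parameter interval. -/
lemma image_variationOnFromTo {γ : ℝ → X} {a b : ℝ} (hab : a ≤ b)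
    (hc : ContinuousOn γ (Icc a b)) (hf : eVariationOn γ (Icc a b) ≠ ∞) :
    Icc 0 (eVariationOn γ (Icc a b)).toReal ⊆ variationOnFromTo γ (Icc a b) a '' Icc a b := by
  have h := intermediate_value_Icc hab (continuousOn_variationOnFromTo hc hf)
  rwa [variationOnFromTo.self, variationOnFromTo.eq_of_le _ _ hab, inter_self] at h

/-- The arc length parametrization of a rectifiable curve is `1`-Lipschitz. -/
lemma dist_naturalParameterization_le {γ : ℝ → X} {a b : ℝ} (hab : a ≤ b)
    (hc : ContinuousOn γ (Icc a b)) (hf : eVariationOn γ (Icc a b) ≠ ∞) :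
    ∀ s ∈ Icc 0 (eVariationOn γ (Icc a b)).toReal, ∀ t ∈ Icc 0 (eVariationOn γ (Icc a b)).toReal,
      dist (naturalParameterization γ (Icc a b) a s) (naturalParameterization γ (Icc a b) a t) ≤
        |s - t| := by
  have hbv : BoundedVariationOn γ (Icc a b) := hf
  have key : ∀ s ∈ Icc 0 (eVariationOn γ (Icc a b)).toReal,
      ∀ t ∈ Icc 0 (eVariationOn γ (Icc a b)).toReal, s ≤ t →
      dist (naturalParameterization γ (Icc a b) a s) (naturalParameterization γ (Icc a b) a t) ≤
        |s - t| := by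
    intro s hs t ht hst
    have hs' := image_variationOnFromTo hab hc hf hs
    have ht' := image_variationOnFromTo hab hc hf ht
    have h1 := has_unit_speed_naturalParameterization γ hbv.locallyBoundedVariationOn
      (left_mem_Icc.2 hab) hs' ht'
    have h2 := eVariationOn.edist_le (naturalParameterization γ (Icc a b) a)
      (s := variationOnFromTo γ (Icc a b) a '' Icc a b ∩ Icc s t)
      ⟨hs', left_mem_Icc.2 hst⟩ ⟨ht', right_mem_Icc.2 hst⟩
    rw [h1, edist_dist, NNReal.coe_one, one_mul] at h2
    rw [abs_sub_comm, abs_of_nonneg (sub_nonneg.2 hst)]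
    exact (ENNReal.ofReal_le_ofReal_iff (sub_nonneg.2 hst)).1 h2
  intro s hs t ht
  rcases le_total s t with h | h
  · exact key s hs t ht h
  · rw [dist_comm, abs_sub_comm]
    exact key t ht s hs h

lemma continuousOn_naturalParameterization {γ : ℝ → X} {a b : ℝ} (hab : a ≤ b)
    (hc : ContinuousOn γ (Icc a b)) (hf : eVariationOn γ (Icc a b) ≠ ∞) :
    ContinuousOn (naturalParameterization γ (Icc a b) a)
      (Icc 0 (eVariationOn γ (Icc a b)).toReal) := by
  refine (LipschitzOnWith.of_dist_le_mul (K := 1) fun s hs t ht => ?_).continuousOn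
  simpa [Real.dist_eq] using dist_naturalParameterization_le hab hc hf s hs t ht

/-- Along a `1`-Lipschitz curve, the increment of `w` is at most the integral of a continuous
function that dominates the slopes of `w`. -/
lemma sub_le_integral_of_slope_le {w G : X → ℝ} (hw : Continuous w) (hG : Continuous G)
    (hwG : ∀ x, ∀ᶠ y in 𝓝 x, w y - w x ≤ G x * dist y x) (hG0 : ∀ x, 0 ≤ G x)
    {p : ℝ → X} {L : ℝ} (hL : 0 ≤ L)
    (hp : ∀ s ∈ Icc 0 L, ∀ t ∈ Icc 0 L, dist (p s) (p t) ≤ |s - t|) :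
    w (p L) - w (p 0) ≤ ∫ t in (0 : ℝ)..L, G (p t) := by
  have hpc : ContinuousOn p (Icc 0 L) := by
    refine (LipschitzOnWith.of_dist_le_mul (K := 1) fun s hs t ht => ?_).continuousOn
    simpa [Real.dist_eq] using hp s hs t ht
  have hGc : ContinuousOn (fun t => G (p t)) (Icc 0 L) := hG.comp_continuousOn hpc
  have hint : IntervalIntegrable (fun t => G (p t)) volume 0 L :=
    ContinuousOn.intervalIntegrable (by rwa [uIcc_of_le hL])
  -- `w ∘ p` need not be differentiable, so it is compared with the primitive of `G ∘ p` through
  -- right slopes; since `p` is `1`-Lipschitz, local slope bounds for `w` pass to `w ∘ p`.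
  refine image_le_of_liminf_slope_right_le_deriv_boundary
    (f := fun t => w (p t) - w (p 0)) (B := fun t => ∫ s in (0 : ℝ)..t, G (p s))
    (B' := fun t => G (p t)) ((hw.comp_continuousOn hpc).sub continuousOn_const)
    (by simp) ?_ ?_ ?_ (right_mem_Icc.2 hL)
  · have := intervalIntegral.continuousOn_primitive_interval (f := fun t => G (p t))
      (μ := volume) (a := 0) (b := L)
      (by rw [uIcc_of_le hL]; exact hGc.integrableOn_Icc)
    rwa [uIcc_of_le hL] at this
  · intro t ht
    have hsub : Ici t ∩ Iio L ⊆ Icc 0 L := fun s hs => ⟨ht.1.trans hs.1, hs.2.le⟩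
    have hmem : Icc 0 L ∈ 𝓝[≥] t :=
      mem_of_superset (inter_mem self_mem_nhdsWithin (mem_nhdsWithin_of_mem_nhds (Iio_mem_nhds ht.2)))
        hsub
    have hmem' : Icc 0 L ∈ 𝓝[>] t := nhdsWithin_mono _ Ioi_subset_Ici_self hmem
    refine intervalIntegral.integral_hasDerivWithinAt_right
      (hint.mono_set (by rw [uIcc_of_le hL, uIcc_of_le ht.1]; exact Icc_subset_Icc_right ht.2.le))
      ?_ ?_
    · exact ⟨Icc 0 L, hmem', hGc.aestronglyMeasurable measurableSet_Icc⟩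
    · exact (hGc t (Ico_subset_Icc_self ht)).mono_of_mem_nhdsWithin hmem'
  · intro t ht r hr
    have hmem : Icc 0 L ∈ 𝓝[>] t := by
      refine mem_of_superset (inter_mem self_mem_nhdsWithin
        (mem_nhdsWithin_of_mem_nhds (Iio_mem_nhds ht.2))) fun s hs => ?_
      exact ⟨ht.1.trans (le_of_lt hs.1), le_of_lt hs.2⟩
    have hpt : Tendsto p (𝓝[>] t) (𝓝 (p t)) :=
      (hpc t (Ico_subset_Icc_self ht)).mono_of_mem_nhdsWithin hmem
    refine Eventually.frequently ?_
    filter_upwards [hpt.eventually (hwG (p t)), hmem, self_mem_nhdsWithin] with s hs hsI hst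
    have hst' : 0 < s - t := sub_pos.2 hst
    rw [slope_def_field, sub_sub_sub_cancel_right, div_lt_iff₀ hst']
    have h1 := hp s hsI t (Ico_subset_Icc_self ht)
    rw [abs_of_pos hst'] at h1
    calc w (p s) - w (p t) ≤ G (p t) * dist (p s) (p t) := hs
      _ ≤ G (p t) * (s - t) := by gcongr; exact hG0 _
      _ < r * (s - t) := by gcongr

variable [MeasurableSpace X] [BorelSpace X]

/-- A continuous function that dominates the local slopes of `w` is an upper gradient of `w`. -/
lemma isUpperGradient_of_slope_le {w G : X → ℝ} (hw : Continuous w) (hG : Continuous G)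
    (hG0 : ∀ x, 0 ≤ G x) (hwG : ∀ x, ∀ᶠ y in 𝓝 x, |w y - w x| ≤ G x * dist y x) (U : Set X) :
    IsUpperGradient U w (fun x => ENNReal.ofReal (G x)) := by
  refine ⟨hG.measurable.ennreal_ofReal, fun γ a b hγ => ?_⟩
  have hbv : BoundedVariationOn γ (Icc a b) := hγ.finite_length
  set L := (eVariationOn γ (Icc a b)).toReal with hLdef
  set p := naturalParameterization γ (Icc a b) a with hpdef
  have hL : 0 ≤ L := ENNReal.toReal_nonneg
  have hp := dist_naturalParameterization_le hγ.le hγ.continuousOn hγ.finite_length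
  have hp0 : p 0 = γ a := by
    have h := edist_naturalParameterization_eq_zero hbv.locallyBoundedVariationOn
      (left_mem_Icc.2 hγ.le) (left_mem_Icc.2 hγ.le)
    rwa [variationOnFromTo.self, edist_eq_zero] at h
  have hpL : p L = γ b := by
    have h := edist_naturalParameterization_eq_zero hbv.locallyBoundedVariationOn
      (left_mem_Icc.2 hγ.le) (right_mem_Icc.2 hγ.le)
    rwa [variationOnFromTo.eq_of_le _ _ hγ.le, inter_self, edist_eq_zero] at h
  have hGc : ContinuousOn (fun t => G (p t)) (Icc 0 L) := hG.comp_continuousOn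
    (continuousOn_naturalParameterization hγ.le hγ.continuousOn hγ.finite_length)
  have h1 := sub_le_integral_of_slope_le hw hG
    (fun x => (hwG x).mono fun y hy => (le_abs_self _).trans hy) hG0 hL hp
  have h2 := sub_le_integral_of_slope_le (w := fun x => - w x) hw.neg hG
    (fun x => (hwG x).mono fun y hy => by
      refine le_trans ?_ hy
      rw [← neg_sub', ← abs_neg]
      exact le_abs_self _) hG0 hL hp
  have h3 : |w (p L) - w (p 0)| ≤ ∫ t in (0 : ℝ)..L, G (p t) :=
    abs_le.2 ⟨by linarith, h1⟩
  rw [arcLengthIntegral, ← hp0, ← hpL, ← hpdef, ← hLdef]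
  refine (ENNReal.ofReal_le_ofReal h3).trans ?_
  rw [intervalIntegral.integral_of_le hL, ← integral_Icc_eq_integral_Ioc,
    ofReal_integral_eq_lintegral_ofReal hGc.integrableOn_Icc
      (ae_of_all _ fun t => hG0 _)]

end ArcLength

/-! ### Doubling measures, boundary layers and regularity of the boundary -/

section Doubling

variable {X : Type*} [MetricSpace X] {Ω : Set X}

lemma isBounded_frontier (hΩ : Bornology.IsBounded Ω) : Bornology.IsBounded (frontier Ω) :=
  hΩ.closure.subset frontier_subset_closure

lemma diam_pos_of_frontier_nonempty (hΩ_open : IsOpen Ω) (hΩ : Bornology.IsBounded Ω)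
    (hfr : (frontier Ω).Nonempty) : 0 < Metric.diam Ω := by
  refine lt_of_le_of_ne Metric.diam_nonneg fun h => ?_
  have hsub : Ω.Subsingleton := fun x hx y hy => dist_le_zero.1
    ((Metric.dist_le_diam_of_mem hΩ hx hy).trans h.ge)
  obtain ⟨x, hx⟩ := hfr
  rw [frontier, hsub.isClosed.closure_eq, hΩ_open.interior_eq, sdiff_self] at hx
  exact hx

variable [MeasurableSpace X] {μ : Measure X}

lemma IsDoubling.measure_ball_pos (hμ : IsDoubling μ) (z : X) {r : ℝ} (hr : 0 < r) :
    0 < μ (Metric.ball z r) := by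
  obtain ⟨C, hC⟩ := hμ
  have h := (hC z (r / 2) (by positivity)).1
  rwa [mul_div_cancel₀ _ (two_ne_zero)] at h

lemma IsDoubling.measure_ball_lt_top (hμ : IsDoubling μ) (z : X) (r : ℝ) :
    μ (Metric.ball z r) < ∞ := by
  rcases le_or_gt r 0 with hr | hr
  · simp [Metric.ball_eq_empty.2 hr]
  obtain ⟨C, hC⟩ := hμ
  have h := hC z (r / 2) (by positivity)
  rw [mul_div_cancel₀ _ (two_ne_zero)] at h
  exact h.2.1.trans_lt h.2.2

lemma IsDoubling.measure_lt_top (hμ : IsDoubling μ) (hΩ : Bornology.IsBounded Ω) : μ Ω < ∞ := by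
  rcases Ω.eq_empty_or_nonempty with rfl | ⟨x, -⟩
  · simp
  obtain ⟨r, hr⟩ := hΩ.subset_ball x
  exact (measure_mono hr).trans_lt (hμ.measure_ball_lt_top x r)

lemma IsDoubling.exists_iterate (hμ : IsDoubling μ) :
    ∃ C : ℝ≥0, ∀ (n : ℕ) (z : X) (r : ℝ), 0 < r →
      μ (Metric.ball z (2 ^ n * r)) ≤ C ^ n * μ (Metric.ball z r) := by
  obtain ⟨C, hC⟩ := hμ
  refine ⟨C, fun n z r hr => ?_⟩
  induction n with
  | zero => simp
  | succ n ih =>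
    calc μ (Metric.ball z (2 ^ (n + 1) * r)) = μ (Metric.ball z (2 * (2 ^ n * r))) := by ring_nf
      _ ≤ C * μ (Metric.ball z (2 ^ n * r)) := (hC z _ (by positivity)).2.1
      _ ≤ C * (C ^ n * μ (Metric.ball z r)) := by gcongr
      _ = C ^ (n + 1) * μ (Metric.ball z r) := by ring

section Nets

variable [BorelSpace X]

/-- A bounded set in a doubling space has a finite net with disjoint balls. -/
lemma IsDoubling.exists_finite_net (hμ : IsDoubling μ) {A : Set X} (hA : Bornology.IsBounded A)
    {ρ : ℝ} (hρ : 0 < ρ) :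
    ∃ S ⊆ A, S.Finite ∧ S.PairwiseDisjoint (fun s => Metric.ball s ρ) ∧
      A ⊆ ⋃ s ∈ S, Metric.closedBall s (5 * ρ) := by
  obtain ⟨S, hSA, hSd, hSc⟩ := Vitali.exists_disjoint_subfamily_covering_enlargement_closedBall
    A (fun x => x) (fun _ => ρ) ρ (fun _ _ => le_rfl) 5 (by norm_num)
  have hSd' : S.PairwiseDisjoint (fun s => Metric.ball s ρ) :=
    hSd.mono fun s => Metric.ball_subset_closedBall
  refine ⟨S, hSA, ?_, hSd', fun a ha => ?_⟩
  · rcases A.eq_empty_or_nonempty with rfl | ⟨x, hx⟩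
    · exact (subset_empty_iff.1 hSA).symm ▸ finite_empty
    obtain ⟨R, hR0, hR⟩ := hA.subset_ball_lt 0 x
    obtain ⟨C, hC⟩ := hμ.exists_iterate
    obtain ⟨n, hn⟩ := pow_unbounded_of_one_lt (2 * R / ρ) one_lt_two
    rw [div_lt_iff₀ hρ] at hn
    -- Each centre `s` has `B(x, R) ⊆ B(s, 2R) ⊆ B(s, 2ⁿ ρ)`, so the disjoint balls have measure
    -- bounded below; they all lie in `B(x, R + ρ)`, which has finite measure, so there are finitely
    -- many.
    have hlow : ∀ s : S, μ (Metric.ball x R) / C ^ n ≤ μ (Metric.ball (s : X) ρ) := by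
      intro s
      refine ENNReal.div_le_of_le_mul' ((measure_mono ?_).trans (hC n s ρ hρ))
      refine Metric.ball_subset_ball' ?_
      have := hR (hSA s.2)
      rw [Metric.mem_ball, dist_comm] at this
      linarith
    have hfin := Measure.finite_const_le_meas_of_disjoint_iUnion μ
      (ε := μ (Metric.ball x R) / C ^ n)
      (ENNReal.div_pos (hμ.measure_ball_pos x hR0).ne' (by finiteness))
      (As := fun s : S => Metric.ball (s : X) ρ) (fun s => Metric.isOpen_ball.measurableSet)
      (fun s t hst => hSd' s.2 t.2 (fun h => hst (Subtype.ext h)))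
      (ne_top_of_le_ne_top (hμ.measure_ball_lt_top x (R + ρ)).ne (measure_mono ?_))
    · have huniv : {s : S | μ (Metric.ball x R) / C ^ n ≤ μ (Metric.ball (s : X) ρ)} = univ :=
        eq_univ_of_forall hlow
      rw [huniv] at hfin
      exact finite_coe_iff.1 (finite_univ_iff.1 hfin)
    · refine iUnion_subset fun s => Metric.ball_subset_ball' ?_
      have := hR (hSA s.2)
      rw [Metric.mem_ball] at this
      linarith
  · obtain ⟨b, hb, hab⟩ := hSc a ha
    exact mem_iUnion₂.2 ⟨b, hb, hab (Metric.mem_closedBall_self hρ.le)⟩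

lemma IsDoubling.isCompact [CompleteSpace X] (hμ : IsDoubling μ) {A : Set X}
    (hA : Bornology.IsBounded A) (hAc : IsClosed A) : IsCompact A := by
  refine TotallyBounded.isCompact_of_isClosed (Metric.totallyBounded_iff.2 fun ε hε => ?_) hAc
  obtain ⟨S, -, hS, -, hcov⟩ := hμ.exists_finite_net hA (ρ := ε / 6) (by positivity)
  refine ⟨S, hS, hcov.trans (iUnion₂_mono fun s _ => Metric.closedBall_subset_ball ?_)⟩
  linarith

lemma boundaryMeasure_ball (z : X) (r : ℝ) :
    boundaryMeasure μ Ω (Metric.ball z r) =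
      codimOneHausdorff μ (Metric.ball z r ∩ frontier Ω) :=
  Measure.restrict_apply Metric.isOpen_ball.measurableSet

/-- Finitely many balls of radius `diam Ω` centred on the bounded boundary cover it, and the upper
regularity bound applies to each. -/
lemma isFiniteMeasure_boundaryMeasure (hμ : IsDoubling μ) (hΩ_open : IsOpen Ω)
    (hΩ : Bornology.IsBounded Ω) (hreg : IsCodimOneRegularBoundary μ Ω) :
    IsFiniteMeasure (boundaryMeasure μ Ω) := by
  rcases (frontier Ω).eq_empty_or_nonempty with hfr | hfr
  · rw [boundaryMeasure, hfr, Measure.restrict_empty]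
    infer_instance
  have hD := diam_pos_of_frontier_nonempty hΩ_open hΩ hfr
  obtain ⟨C, -, hC⟩ := hreg
  obtain ⟨S, hSA, hS, -, hcov⟩ :=
    hμ.exists_finite_net (isBounded_frontier hΩ) (ρ := Metric.diam Ω / 6) (by positivity)
  refine ⟨?_⟩
  rw [boundaryMeasure, Measure.restrict_apply MeasurableSet.univ, univ_inter]
  have hcov' : frontier Ω ⊆ ⋃ s ∈ S, (Metric.ball s (Metric.diam Ω) ∩ frontier Ω) := by
    intro x hx
    obtain ⟨s, hs, hxs⟩ := mem_iUnion₂.1 (hcov hx)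
    exact mem_iUnion₂.2 ⟨s, hs, Metric.closedBall_subset_ball (by linarith) hxs, hx⟩
  refine (measure_mono hcov').trans_lt ?_
  refine measure_biUnion_lt_top hS fun s hs => ?_
  refine ((hC s (hSA hs) _ hD le_rfl).2).trans_lt ?_
  have h1 := (hμ.measure_ball_lt_top s (Metric.diam Ω)).ne
  have h2 : ENNReal.ofReal (Metric.diam Ω) ≠ 0 := by simpa using hD
  exact ENNReal.mul_lt_top (by simp) (ENNReal.div_lt_top h1 h2)

/-- The integral over a boundary layer of width `ρ` of a function with oscillation at most `ω` at
scale `ρ` is controlled by `ρ` times its integral over the boundary. -/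
lemma exists_lintegral_layer_le (hμ : IsDoubling μ) (hΩ : Bornology.IsBounded Ω)
    (hfr : (frontier Ω).Nonempty) (hreg : IsCodimOneRegularBoundary μ Ω) :
    ∃ K : ℝ≥0, ∀ ρ : ℝ, 0 < ρ → ρ ≤ Metric.diam Ω → ∀ (φ : X → ℝ≥0∞) (ω : ℝ≥0∞),
      (∀ x y, dist x y < 8 * ρ → φ x ≤ φ y + ω) →
      ∫⁻ x in {x | Metric.infDist x (frontier Ω) < ρ}, φ x ∂μ ≤
        K * ENNReal.ofReal ρ * ∫⁻ y, (φ y + ω) ∂(boundaryMeasure μ Ω) := by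
  obtain ⟨C, hC⟩ := hμ.exists_iterate
  obtain ⟨A, hA1, hA⟩ := hreg
  -- Three doublings take radius `ρ` to `8ρ ≥ 6ρ`; `A` is the lower regularity constant.
  refine ⟨C ^ 3 * A, fun ρ hρ hρD φ ω hφ => ?_⟩
  obtain ⟨S, hSA, hS, hSd, hcov⟩ := hμ.exists_finite_net (isBounded_frontier hΩ) hρ
  have : Countable S := hS.countable.to_subtype
  -- A point of the layer is within `ρ` of the boundary, and the net is `5ρ`-dense there, hence the
  -- radius `6ρ`.
  have hsub : {x | Metric.infDist x (frontier Ω) < ρ} ⊆ ⋃ s : S, Metric.ball (s : X) (6 * ρ) := by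
    intro x hx
    obtain ⟨y, hy, hxy⟩ := (Metric.infDist_lt_iff hfr).1 hx
    obtain ⟨s, hs, hys⟩ := mem_iUnion₂.1 (hcov hy)
    refine mem_iUnion.2 ⟨⟨s, hs⟩, ?_⟩
    rw [Metric.mem_closedBall] at hys
    rw [Metric.mem_ball]
    linarith [dist_triangle x y s]
  have hball : ∀ s : S, ∫⁻ x in Metric.ball (s : X) (6 * ρ), φ x ∂μ ≤
      (C ^ 3 * A : ℝ≥0) * ENNReal.ofReal ρ *
        ∫⁻ y in Metric.ball (s : X) ρ, (φ y + ω) ∂(boundaryMeasure μ Ω) := by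
    intro s
    -- The supremum carries the integral from `μ` on `B(s, 6ρ)` to the boundary measure on `B(s,
    -- ρ)`: points of the two balls are less than `7ρ` apart, so `M ≤ φ y + ω` for every `y` in the
    -- small ball.
    set M := ⨆ x ∈ Metric.ball (s : X) (6 * ρ), φ x
    have h1 : ∫⁻ x in Metric.ball (s : X) (6 * ρ), φ x ∂μ ≤
        M * μ (Metric.ball (s : X) (6 * ρ)) := by
      rw [← setLIntegral_const]
      exact setLIntegral_mono' Metric.isOpen_ball.measurableSet
        fun x hx => le_iSup₂ (f := fun x (_ : x ∈ Metric.ball (s : X) (6 * ρ)) => φ x) x hx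
    have h2 : M * boundaryMeasure μ Ω (Metric.ball (s : X) ρ) ≤
        ∫⁻ y in Metric.ball (s : X) ρ, (φ y + ω) ∂(boundaryMeasure μ Ω) := by
      rw [← setLIntegral_const]
      refine setLIntegral_mono' Metric.isOpen_ball.measurableSet fun y hy => iSup₂_le fun x hx =>
        hφ x y ?_
      rw [Metric.mem_ball] at hx hy
      linarith [dist_triangle_right x y s]
    have h3 : μ (Metric.ball (s : X) (6 * ρ)) ≤
        C ^ 3 * A * ENNReal.ofReal ρ * boundaryMeasure μ Ω (Metric.ball (s : X) ρ) := by
      have h4 := (hA s (hSA s.2) ρ hρ hρD).1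
      rw [← boundaryMeasure_ball, ENNReal.inv_mul_le_iff (by positivity) (by simp),
        ENNReal.div_le_iff (by simpa using hρ) (by simp)] at h4
      calc μ (Metric.ball (s : X) (6 * ρ)) ≤ μ (Metric.ball (s : X) (2 ^ 3 * ρ)) :=
            measure_mono (Metric.ball_subset_ball (by linarith))
        _ ≤ C ^ 3 * μ (Metric.ball (s : X) ρ) := hC 3 s ρ hρ
        _ ≤ C ^ 3 * (A * boundaryMeasure μ Ω (Metric.ball (s : X) ρ) * ENNReal.ofReal ρ) := by
            gcongr
        _ = _ := by ring
    calc ∫⁻ x in Metric.ball (s : X) (6 * ρ), φ x ∂μ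
        ≤ M * (C ^ 3 * A * ENNReal.ofReal ρ * boundaryMeasure μ Ω (Metric.ball (s : X) ρ)) :=
          h1.trans (by gcongr)
      _ = C ^ 3 * A * ENNReal.ofReal ρ * (M * boundaryMeasure μ Ω (Metric.ball (s : X) ρ)) := by
          ring
      _ ≤ _ := by push_cast; gcongr
  calc ∫⁻ x in {x | Metric.infDist x (frontier Ω) < ρ}, φ x ∂μ
      ≤ ∫⁻ x in ⋃ s : S, Metric.ball (s : X) (6 * ρ), φ x ∂μ := lintegral_mono_set hsub
    _ ≤ ∑' s : S, ∫⁻ x in Metric.ball (s : X) (6 * ρ), φ x ∂μ := lintegral_iUnion_le _ _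
    _ ≤ ∑' s : S, (C ^ 3 * A : ℝ≥0) * ENNReal.ofReal ρ *
        ∫⁻ y in Metric.ball (s : X) ρ, (φ y + ω) ∂(boundaryMeasure μ Ω) :=
        ENNReal.tsum_le_tsum hball
    _ = (C ^ 3 * A : ℝ≥0) * ENNReal.ofReal ρ *
        ∫⁻ y in ⋃ s : S, Metric.ball (s : X) ρ, (φ y + ω) ∂(boundaryMeasure μ Ω) := by
        rw [ENNReal.tsum_mul_left]
        congr 1
        exact (lintegral_iUnion (s := fun s : S => Metric.ball (s : X) ρ)
          (fun s => Metric.isOpen_ball.measurableSet)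
          (fun s t hst => hSd s.2 t.2 (fun h => hst (Subtype.ext h))) _).symm
    _ ≤ _ := by gcongr; exact Measure.restrict_le_self

/-- The boundary is compact, so it has a finite `r / 2`-net. Around each net point `B(y, r/2) ∩ Ω`
contains a ball, hence has positive measure, and every `B(z, r)` contains one of the balls `B(y,
r/2)`. -/
lemma iInf_measure_ball_inter_pos [CompleteSpace X] (hμ : IsDoubling μ) (hΩ_open : IsOpen Ω)
    (hΩ : Bornology.IsBounded Ω) {r : ℝ} (hr : 0 < r) :
    0 < ⨅ z ∈ frontier Ω, μ (Metric.ball z r ∩ Ω) := by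
  obtain ⟨t, ht, htf, hcov⟩ := Metric.finite_approx_of_totallyBounded
    (hμ.isCompact (isBounded_frontier hΩ) isClosed_frontier).totallyBounded (r / 2) (by positivity)
  have hpos : ∀ y ∈ frontier Ω, 0 < μ (Metric.ball y (r / 2) ∩ Ω) := by
    intro y hy
    obtain ⟨x, hx, hxΩ⟩ := mem_closure_iff.1 (frontier_subset_closure hy) _ Metric.isOpen_ball
      (Metric.mem_ball_self (half_pos hr))
    obtain ⟨ε, hε, hsub⟩ := Metric.isOpen_iff.1 (Metric.isOpen_ball.inter hΩ_open) x ⟨hx, hxΩ⟩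
    exact (hμ.measure_ball_pos x hε).trans_le (measure_mono hsub)
  have hmin : 0 < htf.toFinset.inf fun y => μ (Metric.ball y (r / 2) ∩ Ω) :=
    (Finset.lt_inf_iff ENNReal.zero_lt_top).2 fun y hy => hpos y (ht (htf.mem_toFinset.1 hy))
  refine hmin.trans_le (le_iInf₂ fun z hz => ?_)
  obtain ⟨y, hy, hzy⟩ := mem_iUnion₂.1 (hcov hz)
  refine (Finset.inf_le (htf.mem_toFinset.2 hy)).trans (measure_mono ?_)
  gcongr
  refine Metric.ball_subset_ball' ?_
  rw [Metric.mem_ball, dist_comm] at hzy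
  linarith

/-- The layers decrease to `∂Ω`, which is disjoint from the open set `Ω`, and `μ Ω` is finite. -/
lemma tendsto_measure_layer (hμ : IsDoubling μ) (hΩ_open : IsOpen Ω)
    (hΩ : Bornology.IsBounded Ω) (hfr : (frontier Ω).Nonempty) :
    Tendsto (fun ρ => μ (Ω ∩ {x | Metric.infDist x (frontier Ω) < ρ})) (𝓝[>] 0) (𝓝 0) := by
  have hopen : ∀ ρ, IsOpen {x | Metric.infDist x (frontier Ω) < ρ} := fun ρ =>
    isOpen_lt (Metric.continuous_infDist_pt _) continuous_const
  have h := tendsto_measure_biInter_gt (μ := μ) (a := (0 : ℝ))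
    (s := fun ρ => Ω ∩ {x | Metric.infDist x (frontier Ω) < ρ})
    (fun ρ _ => (hΩ_open.inter (hopen ρ)).measurableSet.nullMeasurableSet)
    (fun i j _ hij => inter_subset_inter_right _ fun x (hx : _ < i) => hx.trans_le hij)
    ⟨1, one_pos, ne_top_of_le_ne_top (hμ.measure_lt_top hΩ).ne (measure_mono inter_subset_left)⟩
  have hempty : ⋂ ρ > (0 : ℝ), Ω ∩ {x | Metric.infDist x (frontier Ω) < ρ} = ∅ := by
    refine eq_empty_of_forall_notMem fun x hx => ?_
    have hxΩ : x ∈ Ω := (mem_iInter₂.1 hx 1 one_pos).1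
    have h0 : Metric.infDist x (frontier Ω) = 0 := by
      refine le_antisymm (le_of_forall_pos_lt_add fun ε hε => ?_) Metric.infDist_nonneg
      rw [zero_add]
      exact (mem_iInter₂.1 hx ε hε).2
    have hmem := (isClosed_frontier.mem_iff_infDist_zero hfr).2 h0
    rw [hΩ_open.frontier_eq] at hmem
    exact hmem.2 hxΩ
  rwa [hempty, measure_empty] at h

end Nets

end Doubling

/-! ### Lipschitz approximation, cutoff functions and the energy of one layer -/

section Cutoff

variable {X : Type*} [MetricSpace X]

/-- `g` is bounded by `Λ` and Lipschitz with constant `Λ`. -/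
structure IsBoundedLipschitz (Λ : ℝ) (g : X → ℝ) : Prop where
  bound : ∀ x, |g x| ≤ Λ
  lipschitz : ∀ x y, |g x - g y| ≤ Λ * dist x y

lemma IsBoundedLipschitz.mono {Λ Λ' : ℝ} {g : X → ℝ} (h : IsBoundedLipschitz Λ g) (hΛ : Λ ≤ Λ') :
    IsBoundedLipschitz Λ' g :=
  ⟨fun x => (h.bound x).trans hΛ,
    fun x y => (h.lipschitz x y).trans (mul_le_mul_of_nonneg_right hΛ dist_nonneg)⟩

lemma IsBoundedLipschitz.continuous {Λ : ℝ} {g : X → ℝ} (h : IsBoundedLipschitz Λ g) :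
    Continuous g := by
  refine (LipschitzWith.of_dist_le_mul (K := Λ.toNNReal) fun x y => ?_).continuous
  rw [Real.dist_eq]
  exact (h.lipschitz x y).trans (mul_le_mul_of_nonneg_right (Real.le_coe_toNNReal Λ) dist_nonneg)

lemma IsBoundedLipschitz.zero : IsBoundedLipschitz 0 (0 : X → ℝ) := ⟨by simp, by simp⟩

lemma IsBoundedLipschitz.add {Λ Λ' : ℝ} {g g' : X → ℝ} (h : IsBoundedLipschitz Λ g)
    (h' : IsBoundedLipschitz Λ' g') : IsBoundedLipschitz (Λ + Λ') (g + g') := by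
  refine ⟨fun x => (abs_add_le _ _).trans (add_le_add (h.bound x) (h'.bound x)), fun x y => ?_⟩
  rw [Pi.add_apply, Pi.add_apply, add_sub_add_comm, add_mul]
  exact (abs_add_le _ _).trans (add_le_add (h.lipschitz x y) (h'.lipschitz x y))

lemma IsBoundedLipschitz.sub {Λ Λ' : ℝ} {g g' : X → ℝ} (h : IsBoundedLipschitz Λ g)
    (h' : IsBoundedLipschitz Λ' g') : IsBoundedLipschitz (Λ + Λ') (g - g') := by
  refine ⟨fun x => (abs_sub _ _).trans (add_le_add (h.bound x) (h'.bound x)), fun x y => ?_⟩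
  rw [Pi.sub_apply, Pi.sub_apply, sub_sub_sub_comm, add_mul]
  exact (abs_sub _ _).trans (add_le_add (h.lipschitz x y) (h'.lipschitz x y))

lemma exists_isBoundedLipschitz_mul_thickenedIndicator (c : ℝ) {δ : ℝ} (hδ : 0 < δ) (F : Set X) :
    ∃ Λ, IsBoundedLipschitz Λ (fun x => c * (thickenedIndicator hδ F x : ℝ)) := by
  set K : ℝ≥0 := δ.toNNReal⁻¹
  have hb : IsBoundedLipschitz (max |c| (|c| * K))
      (fun x => c * (thickenedIndicator hδ F x : ℝ)) := by
    refine ⟨fun x => ?_, fun x y => ?_⟩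
    · rw [abs_mul, NNReal.abs_eq]
      refine le_trans ?_ (le_max_left _ _)
      exact mul_le_of_le_one_right (abs_nonneg c)
        (by exact_mod_cast thickenedIndicator_le_one hδ F x)
    · rw [← mul_sub, abs_mul]
      have h := (lipschitzWith_thickenedIndicator hδ F).dist_le_mul x y
      rw [NNReal.dist_eq] at h
      calc |c| * |(thickenedIndicator hδ F x : ℝ) - thickenedIndicator hδ F y|
          ≤ |c| * (K * dist x y) := by gcongr
        _ = |c| * K * dist x y := by ring
        _ ≤ _ := by gcongr; exact le_max_right _ _
  exact ⟨_, hb⟩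

/-- Bounded Lipschitz functions are dense in `L¹` of a finite Borel measure. -/
lemma exists_isBoundedLipschitz_eLpNorm_sub_le [MeasurableSpace X] [BorelSpace X] {ν : Measure X}
    [IsFiniteMeasure ν] {f : X → ℝ} (hf : MemLp f 1 ν) {ε : ℝ≥0∞} (hε : ε ≠ 0) :
    ∃ g : X → ℝ, eLpNorm (f - g) 1 ν ≤ ε ∧ ∃ Λ, IsBoundedLipschitz Λ g := by
  refine MemLp.induction_dense ENNReal.one_ne_top _ ?_ ?_ ?_ hf hε
  · intro c s hs hsν ε hε
    obtain ⟨η, hη0, hη⟩ := ENNReal.exists_nnreal_pos_mul_lt (a := 2 * ‖c‖ₑ) (by finiteness) hε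
    have hη0' : (η : ℝ≥0∞) ≠ 0 := by simpa using hη0.ne'
    obtain ⟨F, hFs, hF, hFν⟩ := hs.exists_isClosed_sdiff_lt hsν.ne hη0'
    have hthick := tendsto_measure_thickening_of_isClosed (μ := ν) ⟨1, one_pos, by finiteness⟩ hF
    have hlt : ν F < ν F + η := ENNReal.lt_add_right (by finiteness) hη0'
    obtain ⟨δ, hδν, hδ⟩ :=
      ((hthick.eventually (gt_mem_nhds hlt)).and self_mem_nhdsWithin).exists
    have hδ : 0 < δ := hδ
    refine ⟨fun x => c * (thickenedIndicator hδ F x : ℝ), ?_,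
      exists_isBoundedLipschitz_mul_thickenedIndicator c hδ F⟩
    have hFt : F ⊆ Metric.thickening δ F := Metric.self_subset_thickening hδ F
    have hdiff : ν (Metric.thickening δ F \ F) ≤ η := by
      rw [measure_sdiff hFt hF.measurableSet.nullMeasurableSet (by finiteness)]
      exact tsub_le_iff_left.2 hδν.le
    -- Off `E` the thickened indicator of `F` agrees with the indicator of `s`; on `E` the two,
    -- scaled by `c`, differ by at most `|c|`.
    set E := (Metric.thickening δ F \ F) ∪ (s \ F)
    calc eLpNorm ((fun x => c * (thickenedIndicator hδ F x : ℝ)) - s.indicator fun _ => c) 1 ν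
        ≤ eLpNorm (E.indicator fun _ => c) 1 ν := by
          refine eLpNorm_mono fun x => ?_
          have h0 : (0 : ℝ) ≤ thickenedIndicator hδ F x := NNReal.coe_nonneg _
          have h1 : (thickenedIndicator hδ F x : ℝ) ≤ 1 := by
            exact_mod_cast thickenedIndicator_le_one hδ F x
          simp only [Pi.sub_apply, Real.norm_eq_abs]
          by_cases hxE : x ∈ E
          · rw [indicator_of_mem hxE]
            by_cases hxs : x ∈ s
            · rw [indicator_of_mem hxs, ← mul_sub_one, abs_mul]
              exact mul_le_of_le_one_right (abs_nonneg c) (abs_le.2 ⟨by linarith, by linarith⟩)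
            · rw [indicator_of_notMem hxs, sub_zero, abs_mul]
              exact mul_le_of_le_one_right (abs_nonneg c) (abs_le.2 ⟨by linarith, by linarith⟩)
          · rw [indicator_of_notMem hxE]
            by_cases hxF : x ∈ F
            · rw [thickenedIndicator_one hδ F hxF, indicator_of_mem (hFs hxF)]
              simp
            · have hxt : x ∉ Metric.thickening δ F := fun h => hxE (Or.inl ⟨h, hxF⟩)
              have hxs : x ∉ s := fun h => hxE (Or.inr ⟨h, hxF⟩)
              rw [thickenedIndicator_zero hδ F hxt, indicator_of_notMem hxs]
              simp
      _ ≤ ‖c‖ₑ * ν E := by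
          have := eLpNorm_indicator_const_le (μ := ν) (s := E) (c := c) 1
          simpa using this
      _ ≤ ‖c‖ₑ * (η + η) := by
          gcongr
          exact (measure_union_le _ _).trans (add_le_add hdiff hFν.le)
      _ = η * (2 * ‖c‖ₑ) := by ring
      _ ≤ ε := hη.le
  · rintro g g' ⟨Λ, h⟩ ⟨Λ', h'⟩
    exact ⟨_, h.add h'⟩
  · rintro g ⟨Λ, h⟩
    exact h.continuous.measurable.aestronglyMeasurable

/-- A Lipschitz cutoff function of the distance to `A` at scale `ρ`: it equals `1` up to distance
`(a - 1) ρ` and vanishes from distance `a ρ` on. -/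
def cutoff (A : Set X) (ρ a : ℝ) (x : X) : ℝ :=
  max 0 (min 1 (a - Metric.infDist x A / ρ))

lemma cutoff_nonneg (A : Set X) (ρ a : ℝ) (x : X) : 0 ≤ cutoff A ρ a x := le_max_left _ _

lemma cutoff_le_one (A : Set X) (ρ a : ℝ) (x : X) : cutoff A ρ a x ≤ 1 :=
  max_le zero_le_one (min_le_left _ _)

lemma continuous_cutoff (A : Set X) (ρ a : ℝ) : Continuous (cutoff A ρ a) :=
  continuous_const.max (continuous_const.min
    (continuous_const.sub ((Metric.continuous_infDist_pt A).div_const ρ)))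

lemma cutoff_eq_one {A : Set X} {ρ a : ℝ} {x : X} (hρ : 0 < ρ)
    (h : Metric.infDist x A ≤ (a - 1) * ρ) : cutoff A ρ a x = 1 := by
  have h1 : Metric.infDist x A / ρ ≤ a - 1 := (div_le_iff₀ hρ).2 h
  rw [cutoff, min_eq_left (by linarith), max_eq_right zero_le_one]

lemma cutoff_eq_zero {A : Set X} {ρ a : ℝ} {x : X} (hρ : 0 < ρ)
    (h : a * ρ ≤ Metric.infDist x A) : cutoff A ρ a x = 0 := by
  have h1 : a ≤ Metric.infDist x A / ρ := (le_div_iff₀ hρ).2 h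
  exact max_eq_left ((min_le_right _ _).trans (by linarith))

lemma cutoff_mono {A : Set X} {ρ a b : ℝ} (hab : a ≤ b) (x : X) :
    cutoff A ρ a x ≤ cutoff A ρ b x := by
  unfold cutoff
  gcongr

lemma abs_cutoff_sub_le (A : Set X) {ρ : ℝ} (hρ : 0 < ρ) (a : ℝ) (x y : X) :
    |cutoff A ρ a x - cutoff A ρ a y| ≤ dist x y / ρ := by
  have h1 : |Metric.infDist x A - Metric.infDist y A| ≤ dist x y := by
    have := (Metric.lipschitz_infDist_pt A).dist_le_mul x y
    simpa [Real.dist_eq] using this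
  unfold cutoff
  refine (abs_max_sub_max_le_max _ _ _ _).trans (max_le (by simp; positivity) ?_)
  refine (abs_min_sub_min_le_max _ _ _ _).trans (max_le (by simp; positivity) ?_)
  rw [sub_sub_sub_cancel_left, ← sub_div, abs_div, abs_of_pos hρ, abs_sub_comm]
  gcongr

/-- The increments of the product of `g` with a cutoff function. -/
lemma abs_mul_cutoff_sub_le {Λ : ℝ} {g : X → ℝ} (hg : IsBoundedLipschitz Λ g) (hΛ : 0 ≤ Λ)
    (A : Set X) {ρ : ℝ} (hρ : 0 < ρ) (a : ℝ) (x y : X) :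
    |g y * cutoff A ρ a y - g x * cutoff A ρ a x| ≤ (Λ + |g x| / ρ) * dist y x := by
  have h1 : g y * cutoff A ρ a y - g x * cutoff A ρ a x =
      (g y - g x) * cutoff A ρ a y + g x * (cutoff A ρ a y - cutoff A ρ a x) := by ring
  rw [h1]
  refine (abs_add_le _ _).trans ?_
  rw [abs_mul, abs_mul, abs_of_nonneg (cutoff_nonneg A ρ a y)]
  calc |g y - g x| * cutoff A ρ a y + |g x| * |cutoff A ρ a y - cutoff A ρ a x|
      ≤ (Λ * dist y x) * 1 + |g x| * (dist y x / ρ) := by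
        gcongr
        · exact cutoff_nonneg A ρ a y
        · exact hg.lipschitz y x
        · exact cutoff_le_one A ρ a y
        · exact abs_cutoff_sub_le A hρ a y x
    _ = _ := by ring

/-- An upper gradient of `g` times a cutoff function at scale `ρ`. -/
def layerGradient (A : Set X) (Λ ρ : ℝ) (g : X → ℝ) (x : X) : ℝ :=
  (Λ + |g x| / ρ) * cutoff A ρ 3 x

lemma layerGradient_nonneg (A : Set X) {Λ ρ : ℝ} (hΛ : 0 ≤ Λ) (hρ : 0 < ρ) (g : X → ℝ) (x : X) :
    0 ≤ layerGradient A Λ ρ g x :=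
  mul_nonneg (by positivity) (cutoff_nonneg _ _ _ _)

lemma IsBoundedLipschitz.continuous_layerGradient {Λ : ℝ} {g : X → ℝ} (hg : IsBoundedLipschitz Λ g)
    (A : Set X) (ρ : ℝ) : Continuous (layerGradient A Λ ρ g) :=
  (continuous_const.add (hg.continuous.abs.div_const ρ)).mul (continuous_cutoff A ρ 3)

/-- The parameter `3` in `layerGradient` makes its cutoff equal to `1` wherever the distance is at
most `2ρ`, while keeping the gradient continuous as the slope criterion demands. Beyond distance
`2ρ` the product vanishes near `x`, so its slope there is zero. -/
lemma isUpperGradient_layerGradient [MeasurableSpace X] [BorelSpace X] {Λ : ℝ} {g : X → ℝ}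
    (hg : IsBoundedLipschitz Λ g) (hΛ : 0 ≤ Λ) (A : Set X) {ρ : ℝ} (hρ : 0 < ρ) (U : Set X) :
    IsUpperGradient U (fun x => g x * cutoff A ρ 2 x)
      (fun x => ENNReal.ofReal (layerGradient A Λ ρ g x)) := by
  refine isUpperGradient_of_slope_le (hg.continuous.mul (continuous_cutoff A ρ 2))
    (hg.continuous_layerGradient A ρ) (layerGradient_nonneg A hΛ hρ g) (fun x => ?_) U
  rcases le_or_gt (Metric.infDist x A) (2 * ρ) with hx | hx
  · refine Eventually.of_forall fun y => ?_
    rw [layerGradient, cutoff_eq_one hρ (a := 3) (by linarith), mul_one]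
    exact abs_mul_cutoff_sub_le hg hΛ A hρ 2 x y
  · filter_upwards [(Metric.continuous_infDist_pt A).continuousAt.eventually (lt_mem_nhds hx)]
      with y hy
    change |g y * cutoff A ρ 2 y - g x * cutoff A ρ 2 x| ≤ _
    rw [cutoff_eq_zero hρ hx.le, cutoff_eq_zero hρ (le_of_lt hy)]
    simpa using mul_nonneg (layerGradient_nonneg A hΛ hρ g x) dist_nonneg

/-- For `ρ ≤ 1` the energy estimate also bounds the `L¹` norm, so no separate estimate is needed. -/
lemma abs_mul_cutoff_le_layerGradient (A : Set X) {Λ ρ : ℝ} (hΛ : 0 ≤ Λ) (hρ : 0 < ρ) (hρ1 : ρ ≤ 1)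
    (g : X → ℝ) (x : X) : |g x * cutoff A ρ 2 x| ≤ layerGradient A Λ ρ g x := by
  rw [abs_mul, abs_of_nonneg (cutoff_nonneg A ρ 2 x), layerGradient]
  refine mul_le_mul ?_ (cutoff_mono (by norm_num) x) (cutoff_nonneg _ _ _ _) (by positivity)
  have : |g x| ≤ |g x| / ρ := le_div_self (abs_nonneg _) hρ hρ1
  linarith

/-- The energy of `g` times a cutoff function at scale `ρ`. -/
lemma exists_lintegral_layerGradient_le [MeasurableSpace X] [BorelSpace X] {μ : Measure X}
    {Ω : Set X} (hμ : IsDoubling μ) (hΩ : Bornology.IsBounded Ω)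
    (hfr : (frontier Ω).Nonempty) (hreg : IsCodimOneRegularBoundary μ Ω) :
    ∃ K : ℝ≥0, ∀ (ρ Λ : ℝ) (g : X → ℝ), 0 < ρ → 3 * ρ ≤ Metric.diam Ω → 0 ≤ Λ →
      IsBoundedLipschitz Λ g →
      ∫⁻ x in Ω, ENNReal.ofReal (layerGradient (frontier Ω) Λ ρ g x) ∂μ ≤
        K * (eLpNorm g 1 (boundaryMeasure μ Ω) +
          ENNReal.ofReal (25 * Λ * ρ) * boundaryMeasure μ Ω univ) := by
  obtain ⟨K, hK⟩ := exists_lintegral_layer_le hμ hΩ hfr hreg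
  refine ⟨3 * K, fun ρ Λ g hρ hρD hΛ hg => ?_⟩
  have hopen : IsOpen {x | Metric.infDist x (frontier Ω) < 3 * ρ} :=
    isOpen_lt (Metric.continuous_infDist_pt _) continuous_const
  have h1 : ∫⁻ x in Ω, ENNReal.ofReal (layerGradient (frontier Ω) Λ ρ g x) ∂μ ≤
      ∫⁻ x in {x | Metric.infDist x (frontier Ω) < 3 * ρ}, ENNReal.ofReal (Λ + |g x| / ρ) ∂μ := by
    rw [← lintegral_indicator hopen.measurableSet]
    refine (setLIntegral_le_lintegral _ _).trans (lintegral_mono fun x => ?_)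
    by_cases hx : Metric.infDist x (frontier Ω) < 3 * ρ
    · rw [indicator_of_mem (by exact hx)]
      exact ENNReal.ofReal_le_ofReal
        (mul_le_of_le_one_right (by positivity) (cutoff_le_one _ _ _ _))
    · rw [layerGradient, cutoff_eq_zero hρ (not_lt.1 hx), mul_zero, ENNReal.ofReal_zero]
      exact zero_le
  have h2 := hK (3 * ρ) (by positivity) hρD (fun x => ENNReal.ofReal (Λ + |g x| / ρ))
    (ENNReal.ofReal (24 * Λ)) (fun x y hxy => by
      rw [← ENNReal.ofReal_add (by positivity) (by positivity)]
      refine ENNReal.ofReal_le_ofReal ?_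
      -- The layer has width `3ρ`, so the points compared are less than `8 · 3ρ = 24ρ` apart.
      have h3 : |g x| ≤ |g y| + 24 * Λ * ρ := by
        have h4 := hg.lipschitz x y
        have h5 := abs_sub_abs_le_abs_sub (g x) (g y)
        nlinarith
      have h6 : |g x| / ρ ≤ |g y| / ρ + 24 * Λ := by
        rw [div_add' _ _ _ hρ.ne']
        gcongr
      linarith)
  refine (h1.trans h2).trans (le_of_eq ?_)
  have hρ' : (ENNReal.ofReal ρ) ≠ 0 := by simpa using hρ
  -- `25` collects `24` from the oscillation and `1` from the term `Λ` of the gradient itself.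
  have h7 : ∀ y, ENNReal.ofReal (Λ + |g y| / ρ) + ENNReal.ofReal (24 * Λ) =
      (ENNReal.ofReal ρ)⁻¹ * (‖g y‖ₑ + ENNReal.ofReal (25 * Λ * ρ)) := by
    intro y
    rw [Real.enorm_eq_ofReal_abs, ← ENNReal.ofReal_add (by positivity) (by positivity),
      ← ENNReal.ofReal_add (by positivity) (by positivity), ← ENNReal.ofReal_inv_of_pos hρ,
      ← ENNReal.ofReal_mul (by positivity)]
    congr 1
    field_simp
    ring
  simp only [h7]
  rw [lintegral_const_mul' _ _ (by simpa using hρ), lintegral_add_right _ measurable_const,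
    lintegral_const, eLpNorm_one_eq_lintegral_enorm, ENNReal.ofReal_mul (by norm_num),
    ENNReal.ofReal_ofNat, ENNReal.coe_mul, ENNReal.coe_ofNat, ← mul_assoc]
  congr 1
  rw [mul_assoc, mul_assoc, ENNReal.mul_inv_cancel hρ' (by simp)]
  ring

end Cutoff

/-! ### The layered sum: telescoping, regularity and upper gradient -/

section LayerSum

variable {X : Type*} [MetricSpace X]

/-- The function that interpolates between `F k` and `F (k + 1)` at distances between `ρ k` and
`2 ρ k` from `A`. -/
def layerSum (A : Set X) (F : ℕ → X → ℝ) (ρ : ℕ → ℝ) (x : X) : ℝ :=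
  ∑' k, (F (k + 1) - F k) x * cutoff A (ρ k) 2 x

/-- A sequence of scales that decreases at least geometrically. -/
structure IsScaleSeq (ρ : ℕ → ℝ) : Prop where
  pos : ∀ k, 0 < ρ k
  half : ∀ k, 2 * ρ (k + 1) ≤ ρ k

namespace IsScaleSeq

variable {ρ : ℕ → ℝ}

lemma antitone (h : IsScaleSeq ρ) : Antitone ρ :=
  antitone_nat_of_succ_le fun k => by linarith [h.pos (k + 1), h.half k]

lemma le_pow (h : IsScaleSeq ρ) (k : ℕ) : ρ k ≤ ρ 0 * (1 / 2) ^ k := by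
  induction k with
  | zero => simp
  | succ k ih =>
    rw [pow_succ]
    linarith [h.half k]

lemma tendsto (h : IsScaleSeq ρ) : Tendsto ρ atTop (𝓝 0) := by
  refine squeeze_zero (fun k => (h.pos k).le) h.le_pow ?_
  simpa using (tendsto_pow_atTop_nhds_zero_of_lt_one (r := (1 / 2 : ℝ)) (by norm_num)
    (by norm_num)).const_mul (ρ 0)

lemma two_mul_le (h : IsScaleSeq ρ) {i k : ℕ} (hik : i < k) : 2 * ρ k ≤ ρ i := by
  obtain ⟨j, rfl⟩ := Nat.exists_eq_add_of_lt hik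
  exact (h.half (i + j)).trans (h.antitone (Nat.le_add_right i j))

end IsScaleSeq

variable {A : Set X} {F : ℕ → X → ℝ} {ρ : ℕ → ℝ}

lemma layerSum_eq_sum (hρ : IsScaleSeq ρ) {x : X} {n : ℕ}
    (hx : ∀ k, n ≤ k → 2 * ρ k ≤ Metric.infDist x A) :
    HasSum (fun k => (F (k + 1) - F k) x * cutoff A (ρ k) 2 x)
      (∑ k ∈ Finset.range n, (F (k + 1) - F k) x * cutoff A (ρ k) 2 x) := by
  refine hasSum_sum_of_ne_finset_zero fun k hk => ?_
  rw [cutoff_eq_zero (hρ.pos k) (hx k (not_lt.1 fun h => hk (Finset.mem_range.2 h))), mul_zero]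

lemma exists_nat_two_mul_le (hρ : IsScaleSeq ρ) {d : ℝ} (hd : 0 < d) :
    ∃ n, ∀ k, n ≤ k → 2 * ρ k ≤ d := by
  obtain ⟨n, hn⟩ := (hρ.tendsto.eventually (gt_mem_nhds (half_pos hd))).exists
  exact ⟨n, fun k hk => by linarith [hρ.antitone hk]⟩

lemma summable_layerSum (hρ : IsScaleSeq ρ) {x : X} (hx : 0 < Metric.infDist x A) :
    Summable fun k => (F (k + 1) - F k) x * cutoff A (ρ k) 2 x := by
  obtain ⟨n, hn⟩ := exists_nat_two_mul_le hρ hx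
  exact (layerSum_eq_sum hρ hn).summable

/-- Off `A`, the value of `layerSum` is a convex combination of two consecutive `F n`, with `n`
determined by the distance to `A`. -/
lemma exists_layerSum_eq (hρ : IsScaleSeq ρ) (hF : F 0 = 0) {x : X}
    (hx : 0 < Metric.infDist x A) :
    ∃ (n : ℕ) (t : ℝ), 0 ≤ t ∧ t ≤ 1 ∧ layerSum A F ρ x = (1 - t) * F n x + t * F (n + 1) x ∧
      ρ n ≤ Metric.infDist x A ∧ (∀ i < n, Metric.infDist x A < ρ i) ∧
      (t = 0 ∨ Metric.infDist x A < 2 * ρ n) := by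
  classical
  have hex : ∃ n, ρ n ≤ Metric.infDist x A := by
    obtain ⟨n, hn⟩ := exists_nat_two_mul_le hρ hx
    exact ⟨n, by linarith [hn n le_rfl, hρ.pos n]⟩
  have hn := Nat.find_spec hex
  have hlt : ∀ i < Nat.find hex, Metric.infDist x A < ρ i := fun i hi =>
    not_le.1 (Nat.find_min hex hi)
  set n := Nat.find hex
  refine ⟨n, cutoff A (ρ n) 2 x, cutoff_nonneg _ _ _ _, cutoff_le_one _ _ _ _, ?_, hn, hlt, ?_⟩
  · have h1 := (layerSum_eq_sum (F := F) hρ (x := x) (n := n + 1)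
      (fun k hk => (hρ.two_mul_le hk).trans hn)).tsum_eq
    rw [layerSum, h1, Finset.sum_range_succ, Finset.sum_congr rfl (g := fun k => F (k + 1) x - F k x)
      (fun k hk => ?_), Finset.sum_range_sub (fun k => F k x), hF]
    · simp only [Pi.sub_apply, Pi.zero_apply]
      ring
    · rw [cutoff_eq_one (hρ.pos k) (by linarith [hlt k (Finset.mem_range.1 hk)]), mul_one,
        Pi.sub_apply]
  · by_cases h : Metric.infDist x A < 2 * ρ n
    · exact Or.inr h
    · exact Or.inl (cutoff_eq_zero (hρ.pos n) (not_lt.1 h))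

/-- Near `x` the distance to `A` stays above half its value at `x`, so the same finitely many terms
survive throughout a neighbourhood. -/
lemma locallyLipschitzOn_layerSum {Λ : ℕ → ℝ} (hρ : IsScaleSeq ρ)
    (hF : ∀ k, IsBoundedLipschitz (Λ k) (F (k + 1) - F k)) (hΛ : ∀ k, 0 ≤ Λ k) {U : Set X}
    (hU : ∀ x ∈ U, 0 < Metric.infDist x A) : LocallyLipschitzOn U (layerSum A F ρ) := by
  intro x hx
  obtain ⟨n, hn⟩ := exists_nat_two_mul_le hρ (half_pos (hU x hx))
  set V := {y | Metric.infDist x A / 2 < Metric.infDist y A}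
  have hV : V ∈ 𝓝 x := (Metric.continuous_infDist_pt A).continuousAt.eventually
    (lt_mem_nhds (half_lt_self (hU x hx)))
  have hsum : ∀ y ∈ V, layerSum A F ρ y =
      ∑ k ∈ Finset.range n, (F (k + 1) - F k) y * cutoff A (ρ k) 2 y := fun y hy =>
    (layerSum_eq_sum hρ fun k hk => (hn k hk).trans (le_of_lt hy)).tsum_eq
  refine ⟨(∑ k ∈ Finset.range n, (Λ k + Λ k / ρ k)).toNNReal, V, mem_nhdsWithin_of_mem_nhds hV,
    LipschitzOnWith.of_dist_le_mul fun y hy z hz => ?_⟩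
  rw [hsum y hy, hsum z hz, Real.dist_eq, ← Finset.sum_sub_distrib]
  refine (Finset.abs_sum_le_sum_abs _ _).trans ?_
  refine le_trans ?_ (mul_le_mul_of_nonneg_right (Real.le_coe_toNNReal _) dist_nonneg)
  rw [Finset.sum_mul]
  refine Finset.sum_le_sum fun k _ => ?_
  refine (abs_mul_cutoff_sub_le (hF k) (hΛ k) A (hρ.pos k) 2 z y).trans ?_
  have := (hρ.pos k).le
  gcongr
  exact (hF k).bound z

variable [MeasurableSpace X]

lemma eLpNorm_layerSum_le {Λ : ℕ → ℝ} (hρ : IsScaleSeq ρ) (hρ1 : ρ 0 ≤ 1)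
    (hΛ : ∀ k, 0 ≤ Λ k) {U : Set X} (μ : Measure X) :
    eLpNorm (layerSum A F ρ) 1 (μ.restrict U) ≤
      ∫⁻ x in U, ∑' k, ENNReal.ofReal (layerGradient A (Λ k) (ρ k) (F (k + 1) - F k) x) ∂μ := by
  rw [eLpNorm_one_eq_lintegral_enorm]
  refine lintegral_mono fun x => enorm_tsum_le_tsum_enorm.trans (ENNReal.tsum_le_tsum fun k => ?_)
  rw [Real.enorm_eq_ofReal_abs]
  exact ENNReal.ofReal_le_ofReal (abs_mul_cutoff_le_layerGradient A (hΛ k) (hρ.pos k)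
    ((hρ.antitone (Nat.zero_le k)).trans hρ1) _ x)

/-- The total variation of a locally Lipschitz function is at most the integral of an upper gradient. -/
lemma totalVariation_le_of_isUpperGradient {μ : Measure X} {U : Set X} {u v : X → ℝ}
    {g : X → ℝ≥0∞} (hv : LocallyLipschitzOn U v) (hvu : v =ᵐ[μ.restrict U] u)
    (hg : IsUpperGradient U v g) : totalVariation μ U u ≤ ∫⁻ x in U, g x ∂μ := by
  refine (iInf_le _ fun _ => v).trans <| (iInf_le _ fun _ => hv).trans <| (iInf_le _ ?_).trans ?_
  · have h0 : eLpNorm (v - u) 1 (μ.restrict U) = 0 := by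
      rw [eLpNorm_congr_ae (g := 0) (hvu.mono fun x hx => by simp [hx]), eLpNorm_zero]
    simp only [h0]
    exact tendsto_const_nhds
  · rw [liminf_const]
    exact iInf₂_le g hg

variable [BorelSpace X]

/-- Upper gradients add up over the series: it converges at both end points of a curve in `U`, so
increments add termwise, and the line integral commutes with a sum of nonnegative functions. -/
lemma isUpperGradient_layerSum {Λ : ℕ → ℝ} (hρ : IsScaleSeq ρ)
    (hF : ∀ k, IsBoundedLipschitz (Λ k) (F (k + 1) - F k)) (hΛ : ∀ k, 0 ≤ Λ k) {U : Set X}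
    (hU : ∀ x ∈ U, 0 < Metric.infDist x A) :
    IsUpperGradient U (layerSum A F ρ)
      (fun x => ∑' k, ENNReal.ofReal (layerGradient A (Λ k) (ρ k) (F (k + 1) - F k) x)) := by
  have hG := fun k => isUpperGradient_layerGradient (hF k) (hΛ k) A (hρ.pos k) U
  refine ⟨Measurable.tsum fun k => (hG k).1, fun γ a b hγ => ?_⟩
  have ha := summable_layerSum (F := F) hρ (hU _ (hγ.mapsTo (left_mem_Icc.2 hγ.le)))
  have hb := summable_layerSum (F := F) hρ (hU _ (hγ.mapsTo (right_mem_Icc.2 hγ.le)))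
  have hp := continuousOn_naturalParameterization hγ.le hγ.continuousOn hγ.finite_length
  rw [layerSum, layerSum, ← hb.tsum_sub ha, ← Real.enorm_eq_ofReal_abs]
  refine enorm_tsum_le_tsum_enorm.trans ?_
  rw [arcLengthIntegral, lintegral_tsum fun k => ?_]
  · refine ENNReal.tsum_le_tsum fun k => ?_
    rw [Real.enorm_eq_ofReal_abs]
    exact (hG k).2 γ a b hγ
  · exact ((((hF k).continuous_layerGradient A (ρ k)).comp_continuousOn hp).aemeasurable
      measurableSet_Icc).ennreal_ofReal

end LayerSum

/-! ### Choice of scales and the trace of the layered sum -/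

section Trace

/-- Choose powers of `1 / 2` along a strictly increasing sequence of exponents; strict increase
gives the halving condition. -/
lemma exists_isScaleSeq {P : ℕ → ℝ → Prop} (hP : ∀ k, ∀ᶠ ρ in 𝓝[>] (0 : ℝ), P k ρ) :
    ∃ ρ, IsScaleSeq ρ ∧ ∀ k, P k (ρ k) := by
  have hlim : Tendsto (fun n : ℕ => (1 / 2 : ℝ) ^ n) atTop (𝓝[>] 0) :=
    tendsto_nhdsWithin_iff.2 ⟨tendsto_pow_atTop_nhds_zero_of_lt_one (by norm_num) (by norm_num),
      Eventually.of_forall fun n => by simp⟩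
  obtain ⟨φ, hφ, hφP⟩ := extraction_forall_of_eventually
    (P := fun k n => P k ((1 / 2 : ℝ) ^ n)) fun k => hlim.eventually (hP k)
  refine ⟨fun k => (1 / 2) ^ φ k, ⟨fun k => by positivity, fun k => ?_⟩, hφP⟩
  have h : (1 / 2 : ℝ) ^ φ (k + 1) ≤ (1 / 2) ^ (φ k + 1) :=
    pow_le_pow_of_le_one (by norm_num) (by norm_num) (hφ (Nat.lt_succ_self k))
  rw [pow_succ] at h
  linarith

/-- Approximation in `L¹` at a geometric rate implies pointwise convergence almost everywhere. -/
lemma ae_tendsto_of_eLpNorm_sub_le {α : Type*} [MeasurableSpace α]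
    {ν : Measure α} {f : α → ℝ} {F : ℕ → α → ℝ} {N : ℝ≥0∞}
    (hN : N ≠ ∞) (hf : AEMeasurable f ν) (hF : ∀ k, AEMeasurable (F k) ν)
    (h : ∀ k, eLpNorm (f - F k) 1 ν ≤ N * (1 / 2) ^ k) :
    ∀ᵐ z ∂ν, Tendsto (fun k => F k z) atTop (𝓝 (f z)) := by
  have hmeas : ∀ k, AEMeasurable (fun z => ‖f z - F k z‖ₑ) ν := fun k => (hf.sub (hF k)).enorm
  have hfin : ∫⁻ z, ∑' k, ‖f z - F k z‖ₑ ∂ν ≠ ∞ := by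
    rw [lintegral_tsum hmeas]
    refine ne_top_of_le_ne_top (b := ∑' k : ℕ, N * (1 / 2) ^ k) ?_
      (ENNReal.tsum_le_tsum fun k => ?_)
    · rw [ENNReal.tsum_mul_left, ENNReal.tsum_geometric]
      refine ENNReal.mul_ne_top hN ?_
      simp
    · rw [← eLpNorm_one_eq_lintegral_enorm]
      exact h k
  filter_upwards [ae_lt_top' (AEMeasurable.tsum hmeas) hfin] with z hz
  have h0 := ENNReal.tendsto_atTop_zero_of_tsum_ne_top hz.ne
  rw [tendsto_iff_edist_tendsto_0]
  simpa only [edist_comm, edist_eq_enorm_sub] using h0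

variable {X : Type*} [MetricSpace X] {F : ℕ → X → ℝ} {Λ ρ : ℕ → ℝ}

/-- A crude sup bound, charged to one of the layers containing `x`. If the distance is below `2 ρ
n`, the layer is the `n`-th; otherwise the value is exactly `F n x` and the charge goes to index `n
- 1`, which is still at least `k`. -/
lemma enorm_layerSum_le {A : Set X} (hρ : IsScaleSeq ρ) (hF0 : F 0 = 0) (hΛ : Monotone Λ)
    (hF : ∀ k x, |F k x| ≤ Λ k) {k : ℕ} {x : X} (hx : 0 < Metric.infDist x A)
    (hxk : Metric.infDist x A < 2 * ρ k) :
    ‖layerSum A F ρ x‖ₑ ≤ ∑' j, {y | Metric.infDist y A < 2 * ρ (k + j)}.indicator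
      (fun _ => ENNReal.ofReal (Λ (k + j + 1))) x := by
  obtain ⟨n, t, ht0, ht1, hu, hn, hlt, ht⟩ := exists_layerSum_eq hρ hF0 hx
  have hkn : k ≤ n := by
    by_contra! h
    linarith [hρ.two_mul_le h]
  rw [Real.enorm_eq_ofReal_abs, hu]
  by_cases hxn : Metric.infDist x A < 2 * ρ n
  · obtain ⟨j, rfl⟩ := Nat.exists_eq_add_of_le hkn
    refine le_trans ?_ (ENNReal.le_tsum j)
    rw [indicator_of_mem (by exact hxn)]
    refine ENNReal.ofReal_le_ofReal ((abs_add_le _ _).trans ?_)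
    rw [abs_mul, abs_mul, abs_of_nonneg ht0, abs_of_nonneg (sub_nonneg.2 ht1)]
    have h1 := (hF (k + j) x).trans (hΛ (Nat.le_succ (k + j)))
    have h2 := hF (k + j + 1) x
    have h3 : 0 ≤ 1 - t := sub_nonneg.2 ht1
    calc (1 - t) * |F (k + j) x| + t * |F (k + j + 1) x|
        ≤ (1 - t) * Λ (k + j + 1) + t * Λ (k + j + 1) := by gcongr
      _ = Λ (k + j + 1) := by ring
  · have ht' : t = 0 := ht.resolve_right hxn
    have hkn' : k < n := lt_of_le_of_ne hkn fun h => hxn (h ▸ hxk)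
    obtain ⟨j, rfl⟩ := Nat.exists_eq_add_of_lt hkn'
    refine le_trans ?_ (ENNReal.le_tsum j)
    rw [indicator_of_mem (show x ∈ {y | Metric.infDist y A < 2 * ρ (k + j)} by
      exact (hlt (k + j) (Nat.lt_succ_self _)).trans (by linarith [hρ.pos (k + j)]))]
    refine ENNReal.ofReal_le_ofReal ?_
    rw [ht', sub_zero, one_mul, zero_mul, add_zero]
    exact hF _ x

/-- Away from the boundary layer of width `2 ρ k`, but at distance less than `ρ N` from the boundary,
`layerSum` is close to the limit of `F` at a boundary point. -/
lemma abs_layerSum_sub_le {A : Set X} (hρ : IsScaleSeq ρ) (hF0 : F 0 = 0) (hΛ : Monotone Λ)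
    (hF : ∀ k, IsBoundedLipschitz (Λ k) (F k)) {N k : ℕ} {x z : X} {c η δ : ℝ}
    (hc : ∀ i, N ≤ i → |F i z - c| ≤ η) (hxz : Λ k * dist x z ≤ δ)
    (hx : 0 < Metric.infDist x A) (hxN : Metric.infDist x A < ρ N)
    (hxk : 2 * ρ k ≤ Metric.infDist x A) :
    |layerSum A F ρ x - c| ≤ δ + η := by
  obtain ⟨n, t, ht0, ht1, hu, hn, hlt, ht⟩ := exists_layerSum_eq hρ hF0 hx
  have hNn : N ≤ n := by
    by_contra! h
    linarith [hρ.antitone h.le]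
  have hnk : n ≤ k := by
    by_contra! h
    linarith [hlt k h, hρ.pos k]
  have hi : ∀ i, N ≤ i → i ≤ k → |F i x - c| ≤ δ + η := fun i hNi hik => by
    calc |F i x - c| ≤ |F i x - F i z| + |F i z - c| := abs_sub_le _ _ _
      _ ≤ Λ k * dist x z + η :=
        add_le_add (((hF i).lipschitz x z).trans
          (mul_le_mul_of_nonneg_right (hΛ hik) dist_nonneg)) (hc i hNi)
      _ ≤ δ + η := by linarith
  have h0 := hi n hNn hnk
  -- Only `F i` with `i ≤ k` are controlled by `Λ k`. For `n < k` both functions involved qualify;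
  -- for `n = k` the weight of `F (k + 1)` is zero because the distance is at least `2 ρ k`.
  rcases hnk.lt_or_eq with hlt' | rfl
  · have h1 := hi (n + 1) (hNn.trans (Nat.le_succ n)) hlt'
    have h2 : layerSum A F ρ x - c = (1 - t) * (F n x - c) + t * (F (n + 1) x - c) := by
      rw [hu]; ring
    rw [h2]
    refine (abs_add_le _ _).trans ?_
    rw [abs_mul, abs_mul, abs_of_nonneg ht0, abs_of_nonneg (sub_nonneg.2 ht1)]
    have h3 : 0 ≤ 1 - t := sub_nonneg.2 ht1
    calc (1 - t) * |F n x - c| + t * |F (n + 1) x - c|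
        ≤ (1 - t) * (δ + η) + t * (δ + η) := by gcongr
      _ = δ + η := by ring
  · have ht' : t = 0 := ht.resolve_right (not_lt.2 hxk)
    rwa [hu, ht', sub_zero, one_mul, zero_mul, add_zero]

variable [MeasurableSpace X]

lemma hasTraceAt_congr {μ : Measure X} {Ω : Set X} {u v : X → ℝ} (huv : u =ᵐ[μ.restrict Ω] v)
    {z : X} {c : ℝ} (h : HasTraceAt μ Ω u z c) : HasTraceAt μ Ω v z c := by
  unfold HasTraceAt at h ⊢
  rw [← h]
  congr 1
  funext r
  refine laverage_congr ?_
  filter_upwards [ae_restrict_of_ae_restrict_of_subset (inter_subset_right) huv] with x hx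
  rw [hx]

lemma hasTrace_congr [BorelSpace X] {μ : Measure X} {Ω : Set X} {u v f : X → ℝ}
    (huv : u =ᵐ[μ.restrict Ω] v) (h : HasTrace μ Ω u f) : HasTrace μ Ω v f :=
  Eventually.mono h fun _ hz => hasTraceAt_congr huv hz

lemma hasTrace_zero [BorelSpace X] {μ : Measure X} {Ω : Set X} {f : X → ℝ}
    (hf : f =ᵐ[boundaryMeasure μ Ω] 0) : HasTrace μ Ω 0 f := by
  filter_upwards [hf] with z hz
  simp [HasTraceAt, hz]

variable [BorelSpace X] {μ : Measure X} {Ω : Set X}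

/-- The layers in which `layerSum` oscillates do not contribute to its means over balls. -/
lemma lintegral_enorm_layerSum_le (hρ : IsScaleSeq ρ) (hF0 : F 0 = 0) (hΛ : Monotone Λ)
    (hF : ∀ k x, |F k x| ≤ Λ k) (hΩ : ∀ x ∈ Ω, 0 < Metric.infDist x (frontier Ω))
    (hΩm : MeasurableSet Ω) {m : ℕ → ℝ≥0∞} (hm : Antitone m)
    (hρm : ∀ k, ENNReal.ofReal (Λ (k + 1)) *
      μ (Ω ∩ {x | Metric.infDist x (frontier Ω) < 2 * ρ k}) ≤ m k * (1 / 2) ^ k) (k : ℕ) :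
    ∫⁻ x in Ω ∩ {x | Metric.infDist x (frontier Ω) < 2 * ρ k},
      ‖layerSum (frontier Ω) F ρ x‖ₑ ∂μ ≤ 2 * (m k * (1 / 2) ^ k) := by
  have hmeas : ∀ i, MeasurableSet {x | Metric.infDist x (frontier Ω) < 2 * ρ i} := fun i =>
    (isOpen_lt (Metric.continuous_infDist_pt _) continuous_const).measurableSet
  calc ∫⁻ x in Ω ∩ {x | Metric.infDist x (frontier Ω) < 2 * ρ k},
      ‖layerSum (frontier Ω) F ρ x‖ₑ ∂μ
      ≤ ∫⁻ x in Ω ∩ {x | Metric.infDist x (frontier Ω) < 2 * ρ k},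
        ∑' j, {y | Metric.infDist y (frontier Ω) < 2 * ρ (k + j)}.indicator
          (fun _ => ENNReal.ofReal (Λ (k + j + 1))) x ∂μ :=
        setLIntegral_mono' (hΩm.inter (hmeas k)) fun x hx =>
          enorm_layerSum_le hρ hF0 hΛ hF (hΩ x hx.1) hx.2
    _ ≤ ∫⁻ x in Ω, ∑' j, {y | Metric.infDist y (frontier Ω) < 2 * ρ (k + j)}.indicator
          (fun _ => ENNReal.ofReal (Λ (k + j + 1))) x ∂μ := lintegral_mono_set inter_subset_left
    _ = ∑' j, ENNReal.ofReal (Λ (k + j + 1)) *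
          μ (Ω ∩ {x | Metric.infDist x (frontier Ω) < 2 * ρ (k + j)}) := by
        rw [lintegral_tsum fun j => (measurable_const.indicator (hmeas _)).aemeasurable]
        congr 1
        funext j
        rw [lintegral_indicator_const (hmeas _), Measure.restrict_apply (hmeas _), inter_comm]
    _ ≤ ∑' j : ℕ, m k * (1 / 2) ^ k * (1 / 2) ^ j := ENNReal.tsum_le_tsum fun j => by
        refine (hρm (k + j)).trans ?_
        rw [mul_assoc, ← pow_add]
        gcongr
        exact hm (Nat.le_add_right k j)
    _ = 2 * (m k * (1 / 2) ^ k) := by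
        rw [ENNReal.tsum_mul_left, ENNReal.tsum_geometric, one_div, ENNReal.one_sub_inv_two, inv_inv,
          mul_comm]

/-- The function `layerSum` has the trace `lim F k z` at `z`. -/
lemma hasTraceAt_layerSum (hρ : IsScaleSeq ρ) (hF0 : F 0 = 0) (hΛ : Monotone Λ)
    (hΛ1 : ∀ k, 1 ≤ Λ k) (hF : ∀ k, IsBoundedLipschitz (Λ k) (F k))
    (hΩ : ∀ x ∈ Ω, 0 < Metric.infDist x (frontier Ω)) (hΩm : MeasurableSet Ω)
    (hρm : ∀ k, ENNReal.ofReal (Λ (k + 1)) *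
      μ (Ω ∩ {x | Metric.infDist x (frontier Ω) < 2 * ρ k}) ≤
        (⨅ z ∈ frontier Ω, μ (Metric.ball z ((1 / 2) ^ (k + 1) / Λ (k + 1)) ∩ Ω)) * (1 / 2) ^ k)
    {z : X} (hz : z ∈ frontier Ω) {c : ℝ} (hc : Tendsto (fun k => F k z) atTop (𝓝 c)) :
    HasTraceAt μ Ω (layerSum (frontier Ω) F ρ) z c := by
  -- Within `rad k` of `z`, each `F i` with `i ≤ k` differs from `F i z` by at most `Λ k * rad k =
  -- 2⁻ᵏ`.
  set rad : ℕ → ℝ := fun k => (1 / 2) ^ k / Λ k with hrad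
  set m : ℕ → ℝ≥0∞ := fun k => ⨅ z ∈ frontier Ω, μ (Metric.ball z (rad (k + 1)) ∩ Ω) with hmdef
  have hΛ0 : ∀ k, 0 < Λ k := fun k => one_pos.trans_le (hΛ1 k)
  have hrad_pos : ∀ k, 0 < rad k := fun k => div_pos (by positivity) (hΛ0 k)
  have hrad_anti : Antitone rad := fun i j hij =>
    div_le_div₀ (by positivity) (pow_le_pow_of_le_one (by norm_num) (by norm_num) hij) (hΛ0 i)
      (hΛ hij)
  have hhalf : Tendsto (fun k : ℕ => (1 / 2 : ℝ) ^ k) atTop (𝓝 0) :=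
    tendsto_pow_atTop_nhds_zero_of_lt_one (by norm_num) (by norm_num)
  have hrad_lim : Tendsto rad atTop (𝓝 0) :=
    squeeze_zero (fun k => (hrad_pos k).le)
      (fun k => div_le_self (by positivity) (hΛ1 k)) hhalf
  have hm : Antitone m := fun i j hij => by
    refine iInf₂_mono fun z _ => measure_mono ?_
    gcongr
    exact hrad_anti (Nat.succ_le_succ hij)
  have hlim : Tendsto (fun k : ℕ => (2 + ‖c‖ₑ) * (1 / 2 : ℝ≥0∞) ^ k) atTop (𝓝 0) := by
    have h := ENNReal.Tendsto.const_mul (a := 2 + ‖c‖ₑ)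
      (ENNReal.tendsto_pow_atTop_nhds_zero_of_lt_one (r := 1 / 2) (by simp))
      (Or.inr (by finiteness))
    simpa using h
  unfold HasTraceAt
  refine Tendsto.limsup_eq (ENNReal.tendsto_nhds_zero.2 fun ε hε => ?_)
  obtain ⟨η, hη0, hη⟩ : ∃ η : ℝ, 0 < η ∧ ENNReal.ofReal (3 * η) ≤ ε := by
    obtain ⟨q, hq0, hq⟩ := ENNReal.lt_iff_exists_nnreal_btwn.1 hε
    refine ⟨q / 3, by simpa using hq0, ?_⟩
    rw [mul_div_cancel₀ _ (by norm_num), ENNReal.ofReal_coe_nnreal]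
    exact hq.le
  obtain ⟨N, hN⟩ := eventually_atTop.1 <|
    ((((tendsto_order.1 (tendsto_iff_dist_tendsto_zero.1 hc)).2 _ hη0).and
      ((tendsto_order.1 hhalf).2 _ hη0)).and
      ((tendsto_order.1 hlim).2 (ENNReal.ofReal η) (by simpa using hη0))).and
      -- This ensures that the index found below is positive, so that minimality at its predecessor
      -- gives `r < rad k`.
      (eventually_ge_atTop 1)
  have hr : ∀ᶠ r : ℝ in 𝓝[>] 0, r < min (ρ N) (rad N) :=
    mem_nhdsWithin_of_mem_nhds (Iio_mem_nhds (lt_min (hρ.pos N) (hrad_pos N)))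
  filter_upwards [hr, self_mem_nhdsWithin] with r hr hr0
  have hr0 : 0 < r := hr0
  obtain ⟨k, hkr, hrk, hNk⟩ : ∃ k, rad (k + 1) ≤ r ∧ r < rad k ∧ N ≤ k := by
    classical
    have hex : ∃ k, rad (k + 1) ≤ r := by
      obtain ⟨k, hk⟩ := ((tendsto_order.1 hrad_lim).2 r hr0).exists
      exact ⟨k, (hrad_anti (Nat.le_succ k)).trans hk.le⟩
    have hNk : N ≤ Nat.find hex := by
      by_contra! h
      have h1 := (hrad_anti h).trans (Nat.find_spec hex)
      exact absurd (hr.trans_le (min_le_right _ _)) (not_lt.2 h1)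
    refine ⟨Nat.find hex, Nat.find_spec hex, ?_, hNk⟩
    have h1 : 1 ≤ Nat.find hex := (hN N le_rfl).2.trans hNk
    have h2 := Nat.find_min hex (Nat.sub_lt h1 one_pos)
    rw [Nat.sub_add_cancel h1] at h2
    exact not_le.1 h2
  set u := layerSum (frontier Ω) F ρ with hu
  set E := {x | Metric.infDist x (frontier Ω) < 2 * ρ k} with hE
  have hEm : MeasurableSet E :=
    (isOpen_lt (Metric.continuous_infDist_pt _) continuous_const).measurableSet
  have hball : MeasurableSet (Metric.ball z r ∩ Ω) := Metric.isOpen_ball.measurableSet.inter hΩm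
  have hmk : m k ≤ μ (Metric.ball z r ∩ Ω) :=
    (iInf₂_le z hz).trans (measure_mono (inter_subset_inter_left _ (Metric.ball_subset_ball hkr)))
  -- Here `2η` is `η` for the oscillation over the ball plus `η` for the distance from `F i z` to
  -- `c`; the layer `E` contributes the third `η`.
  have hpt : ∀ x ∈ (Metric.ball z r ∩ Ω) \ E,
      ENNReal.ofReal |u x - c| ≤ ENNReal.ofReal (2 * η) := by
    rintro x ⟨⟨hxz, hxΩ⟩, hxE⟩
    refine ENNReal.ofReal_le_ofReal ?_
    have hxz : dist x z < r := hxz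
    have h1 : Λ k * dist x z ≤ η := by
      have h2 : Λ k * rad k = (1 / 2) ^ k := mul_div_cancel₀ _ (hΛ0 k).ne'
      have h3 : Λ k * dist x z ≤ Λ k * rad k :=
        mul_le_mul_of_nonneg_left (hxz.trans hrk).le (hΛ0 k).le
      linarith [(hN k hNk).1.1.2]
    have h2 := abs_layerSum_sub_le hρ hF0 hΛ hF
      (fun i hi => (hN i hi).1.1.1.le) h1 (hΩ x hxΩ)
      (((Metric.infDist_le_dist_of_mem hz).trans_lt hxz).trans (hr.trans_le (min_le_left _ _)))
      (not_lt.1 hxE)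
    linarith
  rw [setLAverage_eq]
  refine ENNReal.div_le_of_le_mul ?_
  calc ∫⁻ x in Metric.ball z r ∩ Ω, ENNReal.ofReal |u x - c| ∂μ
      = ∫⁻ x in (Metric.ball z r ∩ Ω) ∩ E, ENNReal.ofReal |u x - c| ∂μ +
        ∫⁻ x in (Metric.ball z r ∩ Ω) \ E, ENNReal.ofReal |u x - c| ∂μ :=
        (lintegral_inter_add_sdiff _ _ hEm).symm
    _ ≤ ∫⁻ x in Ω ∩ E, (‖u x‖ₑ + ‖c‖ₑ) ∂μ +
        ∫⁻ x in (Metric.ball z r ∩ Ω) \ E, ENNReal.ofReal (2 * η) ∂μ := by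
        refine add_le_add ?_ (setLIntegral_mono' (hball.diff hEm) hpt)
        refine (lintegral_mono fun x => ?_).trans
          (lintegral_mono_set (inter_subset_inter_left _ inter_subset_right))
        rw [← Real.enorm_eq_ofReal_abs]
        exact enorm_sub_le
    _ ≤ (2 * (m k * (1 / 2) ^ k) + ‖c‖ₑ * (m k * (1 / 2) ^ k)) +
        ENNReal.ofReal (2 * η) * μ (Metric.ball z r ∩ Ω) := by
        rw [lintegral_add_right _ measurable_const, setLIntegral_const, setLIntegral_const]
        gcongr
        · exact lintegral_enorm_layerSum_le hρ hF0 hΛ (fun k => (hF k).bound) hΩ hΩm hm hρm k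
        · refine le_trans ?_ (hρm k)
          exact le_mul_of_one_le_left zero_le (by simpa using hΛ1 (k + 1))
        · exact sdiff_subset
    _ = (2 + ‖c‖ₑ) * (1 / 2) ^ k * m k + ENNReal.ofReal (2 * η) * μ (Metric.ball z r ∩ Ω) := by
        ring
    _ ≤ ENNReal.ofReal η * μ (Metric.ball z r ∩ Ω) +
        ENNReal.ofReal (2 * η) * μ (Metric.ball z r ∩ Ω) := by
        gcongr
        exact (hN k hNk).1.2.le
    _ = ENNReal.ofReal (3 * η) * μ (Metric.ball z r ∩ Ω) := by
        rw [← add_mul, ← ENNReal.ofReal_add hη0.le (by positivity)]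
        ring_nf
    _ ≤ ε * μ (Metric.ball z r ∩ Ω) := by gcongr

end Trace

/-! ### Approximating sequences and the extension of one function -/

section Extension

variable {X : Type*} [MetricSpace X]

lemma infDist_frontier_pos {Ω : Set X} (hΩ_open : IsOpen Ω) (hfr : (frontier Ω).Nonempty) :
    ∀ x ∈ Ω, 0 < Metric.infDist x (frontier Ω) := fun x hx =>
  (isClosed_frontier.notMem_iff_infDist_pos hfr).1 fun h => by
    rw [hΩ_open.frontier_eq] at h
    exact h.2 hx

variable [MeasurableSpace X]

/-- Bounded Lipschitz approximations of an `L¹` function at a geometric rate, starting from `0`. -/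
lemma exists_seq_isBoundedLipschitz [BorelSpace X] {ν : Measure X} [IsFiniteMeasure ν] {f : X → ℝ}
    (hf : MemLp f 1 ν) (hf0 : eLpNorm f 1 ν ≠ 0) :
    ∃ (F : ℕ → X → ℝ) (Λ : ℕ → ℝ), F 0 = 0 ∧ Monotone Λ ∧ (∀ k, 1 ≤ Λ k) ∧
      (∀ k, IsBoundedLipschitz (Λ k) (F k)) ∧
      ∀ k, eLpNorm (f - F k) 1 ν ≤ eLpNorm f 1 ν * (1 / 2) ^ k := by
  have key : ∀ k : ℕ, ∃ g : X → ℝ, (k = 0 → g = 0) ∧ (∃ Λ, IsBoundedLipschitz Λ g) ∧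
      eLpNorm (f - g) 1 ν ≤ eLpNorm f 1 ν * (1 / 2) ^ k := by
    intro k
    rcases Nat.eq_zero_or_pos k with rfl | hk
    · exact ⟨0, fun _ => rfl, ⟨0, .zero⟩, by simp⟩
    · obtain ⟨g, hg, hΛ⟩ := exists_isBoundedLipschitz_eLpNorm_sub_le hf
        (ε := eLpNorm f 1 ν * (1 / 2) ^ k) (mul_ne_zero hf0 (pow_ne_zero _ (by simp)))
      exact ⟨g, fun h => absurd h hk.ne', hΛ, hg⟩
  choose F hF0 hFΛ hFf using key
  choose c hc using hFΛ
  -- Partial sums of `|c i|`, shifted by `1`, dominate each Lipschitz bound while being monotone and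
  -- at least `1`.
  have hmono : Monotone fun k => 1 + ∑ i ∈ Finset.range (k + 1), |c i| := by
    intro i j hij
    have : Finset.range (i + 1) ⊆ Finset.range (j + 1) := Finset.range_mono (by lia)
    exact add_le_add le_rfl (Finset.sum_le_sum_of_subset_of_nonneg this fun _ _ _ => abs_nonneg _)
  refine ⟨F, fun k => 1 + ∑ i ∈ Finset.range (k + 1), |c i|, hF0 0 rfl, hmono, fun k => ?_,
    fun k => (hc k).mono ?_, hFf⟩
  · exact le_add_of_nonneg_right (Finset.sum_nonneg fun _ _ => abs_nonneg _)
  · have := Finset.single_le_sum (f := fun i => |c i|) (fun i _ => abs_nonneg (c i))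
      (Finset.mem_range.2 (Nat.lt_succ_self k))
    linarith [le_abs_self (c k)]

variable {μ : Measure X} {Ω : Set X}

lemma bvNorm_congr {u v : X → ℝ} (huv : u =ᵐ[μ.restrict Ω] v) : bvNorm μ Ω u = bvNorm μ Ω v := by
  have h : ∀ w : X → ℝ, eLpNorm (w - u) 1 (μ.restrict Ω) = eLpNorm (w - v) 1 (μ.restrict Ω) :=
    fun w => eLpNorm_congr_ae (huv.mono fun x hx => by simp [hx])
  simp only [bvNorm, totalVariation, h, eLpNorm_congr_ae huv]

lemma bvNorm_zero : bvNorm μ Ω 0 = 0 := by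
  have h : totalVariation μ Ω (0 : X → ℝ) ≤ 0 := by
    refine (totalVariation_le_of_isUpperGradient (v := 0) (g := 0) ?_ (ae_eq_refl _) ?_).trans ?_
    · exact (LipschitzWith.const (0 : ℝ)).locallyLipschitz.locallyLipschitzOn
    · exact ⟨measurable_const, by simp⟩
    · simp
  rw [bvNorm, eLpNorm_zero, zero_add]
  exact le_antisymm h zero_le

/-- A function of finite `BV` norm, as an element of `BV`. -/
lemma exists_mem_BV_ae_eq {v : X → ℝ} (hv : AEStronglyMeasurable v (μ.restrict Ω))
    (hfin : bvNorm μ Ω v < ∞) :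
    ∃ u : BV μ Ω, v =ᵐ[μ.restrict Ω] (u : Lp ℝ 1 (μ.restrict Ω)) := by
  have hmem : MemLp v 1 (μ.restrict Ω) := ⟨hv, (self_le_add_right _ _).trans_lt hfin⟩
  have hae : v =ᵐ[μ.restrict Ω] hmem.toLp v := hmem.coeFn_toLp.symm
  refine ⟨⟨hmem.toLp v, ?_⟩, hae⟩
  have h := bvNorm_congr hae
  exact (self_le_add_left _ _).trans_lt (h ▸ hfin)

variable [BorelSpace X]

/-- The extension of a nonzero boundary function. -/
lemma exists_extension [CompleteSpace X] (hμ : IsDoubling μ) (hΩ_open : IsOpen Ω)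
    (hΩ : Bornology.IsBounded Ω) (hfr : (frontier Ω).Nonempty)
    (hreg : IsCodimOneRegularBoundary μ Ω) :
    ∃ C : ℝ≥0, ∀ f : X → ℝ, MemLp f 1 (boundaryMeasure μ Ω) →
      eLpNorm f 1 (boundaryMeasure μ Ω) ≠ 0 →
      ∃ v : X → ℝ, ContinuousOn v Ω ∧
        bvNorm μ Ω v ≤ C * eLpNorm f 1 (boundaryMeasure μ Ω) ∧ HasTrace μ Ω v f := by
  have := isFiniteMeasure_boundaryMeasure hμ hΩ_open hΩ hreg
  obtain ⟨K, hK⟩ := exists_lintegral_layerGradient_le hμ hΩ hfr hreg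
  refine ⟨12 * K, fun f hf hf0 => ?_⟩
  set ν := boundaryMeasure μ Ω with hν
  set N := eLpNorm f 1 ν with hN
  have hNtop : N ≠ ∞ := hf.2.ne
  obtain ⟨F, Λ, hF0, hΛ, hΛ1, hF, hFf⟩ := exists_seq_isBoundedLipschitz hf hf0
  have hD := diam_pos_of_frontier_nonempty hΩ_open hΩ hfr
  have hpos := infDist_frontier_pos hΩ_open hfr
  have hNk : ∀ k : ℕ, 0 < N * (1 / 2) ^ k := fun k =>
    pos_iff_ne_zero.2 (mul_ne_zero hf0 (pow_ne_zero _ (by simp)))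
  -- The conditions serve, in order: the `L¹` bound by the energy, the use of boundary regularity at
  -- radius `3ρ`, the absorption of the Lipschitz error into `N 2⁻ᵏ`, and the trace. Each holds for
  -- all small `ρ`, the third because `N ≠ 0`.
  obtain ⟨ρ, hρ, hρP⟩ := exists_isScaleSeq (P := fun k ρ => ρ ≤ 1 ∧ 3 * ρ ≤ Metric.diam Ω ∧
    ENNReal.ofReal (25 * (Λ (k + 1) + Λ k) * ρ) * ν univ ≤ N * (1 / 2) ^ k ∧
    ENNReal.ofReal (Λ (k + 1)) * μ (Ω ∩ {x | Metric.infDist x (frontier Ω) < 2 * ρ}) ≤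
      (⨅ z ∈ frontier Ω, μ (Metric.ball z ((1 / 2) ^ (k + 1) / Λ (k + 1)) ∩ Ω)) * (1 / 2) ^ k) (by
    intro k
    have hid : Tendsto (fun ρ : ℝ => ρ) (𝓝[>] 0) (𝓝 0) := tendsto_nhdsWithin_of_tendsto_nhds tendsto_id
    have hmul : ∀ c : ℝ, Tendsto (fun ρ : ℝ => c * ρ) (𝓝[>] 0) (𝓝 0) := fun c => by
      simpa using hid.const_mul c
    refine (hid.eventually (ge_mem_nhds one_pos)).and
      (((hmul 3).eventually (ge_mem_nhds hD)).and (.and ?_ ?_))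
    · have h := ENNReal.Tendsto.mul_const (b := ν univ)
        (ENNReal.tendsto_ofReal (hmul (25 * (Λ (k + 1) + Λ k)))) (Or.inr (measure_ne_top ν _))
      rw [ENNReal.ofReal_zero, zero_mul] at h
      exact h.eventually (ge_mem_nhds (hNk k))
    · have h2 : Tendsto (fun ρ : ℝ => 2 * ρ) (𝓝[>] 0) (𝓝[>] 0) :=
        tendsto_nhdsWithin_iff.2 ⟨hmul 2, by
          filter_upwards [self_mem_nhdsWithin] with r hr
          exact mul_pos two_pos (mem_Ioi.1 hr)⟩
      have h := ENNReal.Tendsto.const_mul (a := ENNReal.ofReal (Λ (k + 1)))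
        ((tendsto_measure_layer hμ hΩ_open hΩ hfr).comp h2) (Or.inr ENNReal.ofReal_ne_top)
      rw [mul_zero] at h
      refine h.eventually (ge_mem_nhds ?_)
      refine pos_iff_ne_zero.2 (mul_ne_zero ?_ (pow_ne_zero _ (by simp)))
      exact (iInf_measure_ball_inter_pos hμ hΩ_open hΩ
        (div_pos (by positivity) (one_pos.trans_le (hΛ1 _)))).ne')
  have hG : ∀ k, IsBoundedLipschitz (Λ (k + 1) + Λ k) (F (k + 1) - F k) := fun k =>
    (hF (k + 1)).sub (hF k)
  have hΛ0 : ∀ k, 0 ≤ Λ (k + 1) + Λ k := fun k => by linarith [hΛ1 k, hΛ1 (k + 1)]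
  have hlip := locallyLipschitzOn_layerSum hρ hG hΛ0 hpos
  refine ⟨layerSum (frontier Ω) F ρ, hlip.continuousOn, ?_, ?_⟩
  · have hI : ∫⁻ x in Ω, ∑' k, ENNReal.ofReal
        (layerGradient (frontier Ω) (Λ (k + 1) + Λ k) (ρ k) (F (k + 1) - F k) x) ∂μ ≤
        6 * K * N := by
      rw [lintegral_tsum fun k => ((hG k).continuous_layerGradient _ _).measurable.ennreal_ofReal
        |>.aemeasurable]
      calc ∑' k, ∫⁻ x in Ω, ENNReal.ofReal
            (layerGradient (frontier Ω) (Λ (k + 1) + Λ k) (ρ k) (F (k + 1) - F k) x) ∂μ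
          -- Of the factor `3`, two come from `‖F (k+1) - F k‖ ≤ ‖f - F k‖ + ‖f - F (k+1)‖` and one
          -- from the Lipschitz error. The geometric series doubles it, and using the bound for both
          -- parts of the norm gives `12`.
          ≤ ∑' k : ℕ, 3 * K * N * (1 / 2) ^ k := ENNReal.tsum_le_tsum fun k => by
            refine (hK (ρ k) _ _ (hρ.pos k) (hρP k).2.1 (hΛ0 k) (hG k)).trans ?_
            have h1 : eLpNorm (F (k + 1) - F k) 1 ν ≤ N * (1 / 2) ^ k + N * (1 / 2) ^ k := by
              have h2 : F (k + 1) - F k = (f - F k) - (f - F (k + 1)) := by abel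
              rw [h2]
              have hm : ∀ i, AEStronglyMeasurable (f - F i) ν := fun i =>
                hf.1.sub (hF i).continuous.measurable.aestronglyMeasurable
              refine (eLpNorm_sub_le (hm k) (hm (k + 1)) le_rfl).trans
                (add_le_add (hFf k) ((hFf (k + 1)).trans ?_))
              gcongr N * ?_
              exact pow_le_pow_of_le_one zero_le (by simp) (Nat.le_succ k)
            calc (K : ℝ≥0∞) * (eLpNorm (F (k + 1) - F k) 1 ν +
                  ENNReal.ofReal (25 * (Λ (k + 1) + Λ k) * ρ k) * ν univ)
                ≤ K * (N * (1 / 2) ^ k + N * (1 / 2) ^ k + N * (1 / 2) ^ k) :=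
                  mul_le_mul' le_rfl (add_le_add h1 (hρP k).2.2.1)
              _ = 3 * K * N * (1 / 2) ^ k := by ring
        _ = 6 * K * N := by
            rw [ENNReal.tsum_mul_left, ENNReal.tsum_geometric, one_div, ENNReal.one_sub_inv_two,
              inv_inv]
            ring
    calc bvNorm μ Ω (layerSum (frontier Ω) F ρ) ≤ 6 * K * N + 6 * K * N :=
          add_le_add ((eLpNorm_layerSum_le hρ (hρP 0).1 hΛ0 μ).trans hI)
            ((totalVariation_le_of_isUpperGradient hlip (ae_eq_refl _)
              (isUpperGradient_layerSum hρ hG hΛ0 hpos)).trans hI)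
      _ = ((12 * K : ℝ≥0) : ℝ≥0∞) * N := by
          push_cast
          ring
  · have hae := ae_tendsto_of_eLpNorm_sub_le hNtop hf.1.aemeasurable
      (fun k => (hF k).continuous.measurable.aemeasurable) hFf
    filter_upwards [hae, ae_restrict_mem isClosed_frontier.measurableSet] with z hz hzfr
    exact hasTraceAt_layerSum hρ hF0 hΛ hΛ1 hF hpos hΩ_open.measurableSet
      (fun k => (hρP k).2.2.2) hzfr hz

lemma exists_zero_extension {f : X → ℝ} (hf : f =ᵐ[boundaryMeasure μ Ω] 0) :
    ∃ u : BV μ Ω, bvNorm μ Ω (u : Lp ℝ 1 (μ.restrict Ω)) = 0 ∧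
      HasTrace μ Ω (u : Lp ℝ 1 (μ.restrict Ω)) f := by
  obtain ⟨u, hu⟩ := exists_mem_BV_ae_eq (μ := μ) (Ω := Ω) (v := 0)
    aestronglyMeasurable_const (by simp [bvNorm_zero])
  exact ⟨u, by rw [← bvNorm_congr hu, bvNorm_zero], hasTrace_congr hu (hasTrace_zero hf)⟩

end Extension

end CodimOneTrace

end

/-! ### The extension operator -/

theorem theorem1p2 {X : Type*} [MetricSpace X] [CompleteSpace X] [MeasurableSpace X] [BorelSpace X]
    (μ : Measure X) (hμ : CodimOneTrace.IsDoubling μ)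
    (Ω : Set X) (hΩ_open : IsOpen Ω) (hΩ_conn : IsConnected Ω) (hΩ_bdd : Bornology.IsBounded Ω)
    (hΩ_reg : CodimOneTrace.IsCodimOneRegularBoundary μ Ω) :
    ∃ Ext : Lp ℝ 1 (CodimOneTrace.boundaryMeasure μ Ω) → CodimOneTrace.BV μ Ω,
      (∃ C : ℝ≥0, ∀ f : Lp ℝ 1 (CodimOneTrace.boundaryMeasure μ Ω),
        CodimOneTrace.bvNorm μ Ω (Ext f : Lp ℝ 1 (μ.restrict Ω)) ≤ C * ‖f‖ₑ) ∧
      ∀ f : Lp ℝ 1 (CodimOneTrace.boundaryMeasure μ Ω),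
        CodimOneTrace.HasTrace μ Ω (Ext f : Lp ℝ 1 (μ.restrict Ω)) f := by
  open CodimOneTrace in
  suffices h : ∃ C : ℝ≥0, ∀ f : Lp ℝ 1 (boundaryMeasure μ Ω), ∃ u : BV μ Ω,
      bvNorm μ Ω (u : Lp ℝ 1 (μ.restrict Ω)) ≤ C * ‖f‖ₑ ∧
      HasTrace μ Ω (u : Lp ℝ 1 (μ.restrict Ω)) f by
    obtain ⟨C, hC⟩ := h
    choose Ext hExt using hC
    exact ⟨Ext, ⟨C, fun f => (hExt f).1⟩, fun f => (hExt f).2⟩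
  rcases (frontier Ω).eq_empty_or_nonempty with hfr | hfr
  -- `Metric.infDist` to the empty set is `0` by convention, so the construction does not apply
  -- here; but the boundary measure is zero and the zero extension suffices.
  · refine ⟨0, fun f => ?_⟩
    have hν : ∀ s, boundaryMeasure μ Ω s = 0 := fun s => by
      rw [boundaryMeasure, hfr, Measure.restrict_empty]
      rfl
    obtain ⟨u, hu, hut⟩ := exists_zero_extension (μ := μ) (Ω := Ω) (f := f)
      (ae_iff.2 (hν _))
    exact ⟨u, by simp [hu], hut⟩
  obtain ⟨C, hC⟩ := exists_extension hμ hΩ_open hΩ_bdd hfr hΩ_reg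
  refine ⟨C, fun f => ?_⟩
  -- For `f = 0` almost everywhere the tolerances `‖f‖ 2⁻ᵏ` would be zero, so this case also takes
  -- the zero extension.
  rcases eq_or_ne (eLpNorm f 1 (boundaryMeasure μ Ω)) 0 with hf0 | hf0
  · obtain ⟨u, hu, hut⟩ := exists_zero_extension (μ := μ) (Ω := Ω) (f := f)
      ((eLpNorm_eq_zero_iff (Lp.aestronglyMeasurable f) one_ne_zero).1 hf0)
    exact ⟨u, by simp [hu], hut⟩
  · obtain ⟨v, hvc, hvn, hvt⟩ := hC f (Lp.memLp f) hf0
    obtain ⟨u, hu⟩ := exists_mem_BV_ae_eq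
      (hvc.aestronglyMeasurable (μ := μ) hΩ_open.measurableSet)
      (hvn.trans_lt (ENNReal.mul_lt_top ENNReal.coe_lt_top (Lp.memLp f).2))
    refine ⟨u, ?_, hasTrace_congr hu hvt⟩
    rw [← bvNorm_congr hu, Lp.enorm_def]
    exact hvn
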